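/- Let $f\in\mathbb{C}[x,y,z,w]$ be a polynomial of degree $D$. For $p,v\in\mathbb{C}^4$ and $i\ge 1$ let $F_i(p;v)=\nabla_v^i f(p)$ be the $i$-th iterated derivative of $f$ at $p$ in direction $v=(v_0,v_1,v_2,v_3)$, which is homogeneous of degree $i$ in $v$ (possibly identically zero). The line $\{p+tv\mid t\in\mathbb{C}\}$ ($v\ne 0$) is said to osculate to $Z(f)=\{f=0\}$ at $p$ to order three if $f(p)=0$ and $F_1(p;v)=F_2(p;v)=F_3(p;v)=0$. For $u=(u_0,u_1,u_2,u_3)$ define the u-resultant $$U(p;u)=\mathrm{Res}_4\bigl(F_1(p;v),\,F_2(p;v),\,F_3(p;v),\,u_0v_0+u_1v_1+u_2v_2+u_3v_3\bigr),$$ where $\mathrm{Res}_4$ is the multipolynomial resultant of four forms of degrees $1,2,3,1$ with respect to the variables $v_0,v_1,v_2,v_3$ (normalized by $\mathrm{Res}_4(v_0,v_1^2,v_2^3,v_3)=1$). Then $U$ is a homogeneous polynomial of degree six in the variables $u_0,u_1,u_2,u_3$ (possibly zero), and its coefficients are polynomials in $p$ of degree $O(D)$, that is, of degree at most $K\cdot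 D$ for an absolute constant $K$ (independent of $f$). Moreover, for every fixed $p\in Z(f)$, the polynomial $U(p;u_0,u_1,u_2,u_3)$ is identically zero as a polynomial in $u_0,u_1,u_2,u_3$ if and only if there are infinitely many directions $v\in\mathbb{P}^3(\mathbb{C})$ such that the line $\{p+tv\mid t\in\mathbb{C}\}$ osculates to $Z(f)$ to order three at $p$. -/

import Mathlib

open MvPolynomial

noncomputable section

/-! ### The multipolynomial resultant -/

section Resultant

variable {σ : Type} [Fintype σ] [DecidableEq σ]

/-- Indices `(i, m)` of the coefficients of a system of forms, one for each `i : σ`, in the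
variables `σ`: `m` runs over the exponents of the monomials of degree `d i`. -/
abbrev CoeffIndex (d : σ → ℕ) : Type :=
  (i : σ) × {m : σ →₀ ℕ // m ∈ (Finset.univ : Finset σ).finsuppAntidiag (d i)}

/-- The universal form of degree `d i`: all its coefficients are independent indeterminates. -/
def universalForm (d : σ → ℕ) (i : σ) : MvPolynomial σ (MvPolynomial (CoeffIndex d) ℂ) :=
  ∑ m : {m : σ →₀ ℕ // m ∈ (Finset.univ : Finset σ).finsuppAntidiag (d i)},
    monomial m.1 (X ⟨i, m⟩)

/-- The elimination ideal (ideal of inertia forms) of the universal forms: the polynomials `a` in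
the coefficients such that for each variable `x_j` some `x_j ^ N * a` lies in the ideal generated
by the universal forms. -/
def eliminationIdeal (d : σ → ℕ) : Ideal (MvPolynomial (CoeffIndex d) ℂ) where
  carrier := {a | ∀ j : σ, ∃ N : ℕ, X j ^ N * C a ∈ Ideal.span (Set.range (universalForm d))}
  zero_mem' := fun j => ⟨0, by simp⟩
  add_mem' := by
    intro a b ha hb j
    obtain ⟨N, hN⟩ := ha j
    obtain ⟨M, hM⟩ := hb j
    refine ⟨N + M, ?_⟩
    have h : (X j : MvPolynomial σ (MvPolynomial (CoeffIndex d) ℂ)) ^ (N + M) * C (a + b)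
        = X j ^ M * (X j ^ N * C a) + X j ^ N * (X j ^ M * C b) := by
      rw [C_add]; ring
    rw [h]
    exact add_mem (Ideal.mul_mem_left _ _ hN) (Ideal.mul_mem_left _ _ hM)
  smul_mem' := by
    intro c a ha j
    obtain ⟨N, hN⟩ := ha j
    refine ⟨N, ?_⟩
    have h : (X j : MvPolynomial σ (MvPolynomial (CoeffIndex d) ℂ)) ^ N * C (c • a)
        = C c * (X j ^ N * C a) := by
      rw [smul_eq_mul, C_mul]; ring
    rw [h]
    exact Ideal.mul_mem_left _ _ hN

/-- Substitution of the coefficients of the forms `G i` into a polynomial in the coefficients. -/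
def evalCoeffs (d : σ → ℕ) {R : Type} [CommRing R] [Algebra ℂ R] (G : σ → MvPolynomial σ R) :
    MvPolynomial (CoeffIndex d) ℂ →ₐ[ℂ] R :=
  aeval fun im : CoeffIndex d => coeff im.2.1 (G im.1)

/-- The multipolynomial resultant in degrees `d i`, as a polynomial in the coefficients of the
universal forms: the generator of the (principal) elimination ideal normalized by
`Res (x_i ^ d_i) = 1`. The normalization makes the generator unique, the units being the nonzero
constants. -/
def universalResultant (d : σ → ℕ) : MvPolynomial (CoeffIndex d) ℂ :=
  Classical.epsilon fun r =>
    eliminationIdeal d = Ideal.span {r} ∧ evalCoeffs d (fun i => (X i : MvPolynomial σ ℂ) ^ d i) r = 1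

/-- The multipolynomial resultant of forms `G i`, regarded as forms of degrees `d i` in the
variables `σ` with coefficients in `R`. -/
def multiResultant (d : σ → ℕ) {R : Type} [CommRing R] [Algebra ℂ R] (G : σ → MvPolynomial σ R) :
    R :=
  evalCoeffs d G (universalResultant d)

end Resultant

/-! ### Directional derivatives and osculation -/

/-- The derivative `∇_v f` of `f` in the direction `v`. -/
def dirDeriv (v : Fin 4 → ℂ) (f : MvPolynomial (Fin 4) ℂ) : MvPolynomial (Fin 4) ℂ :=
  ∑ j, C (v j) * pderiv j f

/-- The line `{p + t v}` osculates to `Z(f)` to order `k` at `p`: `f` and its iterated derivatives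
in the direction `v` vanish at `p` up to order `k` (order `0` says `f p = 0`). -/
def Osculates (f : MvPolynomial (Fin 4) ℂ) (p v : Fin 4 → ℂ) (k : ℕ) : Prop :=
  ∀ i ≤ k, eval p ((dirDeriv v)^[i] f) = 0

/-- `F_i(p; v) = ∇_v^i f(p)` as a polynomial in `v` (outer variables) whose coefficients are
polynomials in `p` (inner variables). -/
def derivForm : ℕ → MvPolynomial (Fin 4) ℂ → MvPolynomial (Fin 4) (MvPolynomial (Fin 4) ℂ)
  | 0, f => C f
  | i + 1, f => ∑ j, X j * derivForm i (pderiv j f)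

lemma derivForm_sum (i : ℕ) (c : Fin 4 → ℂ) (g : Fin 4 → MvPolynomial (Fin 4) ℂ) :
    derivForm i (∑ j, C (c j) * g j) = ∑ j, C (C (c j)) * derivForm i (g j) := by
  induction i generalizing g with
  | zero => simp [derivForm]
  | succ i ih =>
    simp only [derivForm, map_sum, pderiv_C_mul, ih, Finset.mul_sum]
    rw [Finset.sum_comm]
    exact Finset.sum_congr rfl fun _ _ => Finset.sum_congr rfl fun _ _ => by ring

/-- The values of `derivForm` are the iterated directional derivatives. -/
lemma eval_derivForm (i : ℕ) (f : MvPolynomial (Fin 4) ℂ) (p v : Fin 4 → ℂ) :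
    eval v (map (eval p) (derivForm i f)) = eval p ((dirDeriv v)^[i] f) := by
  induction i generalizing f with
  | zero => simp [derivForm]
  | succ i ih =>
    rw [Function.iterate_succ_apply, ← ih, dirDeriv, derivForm_sum]
    simp [derivForm]

/-! ### The u-resultant -/

/-- The u-resultant `U(p; u) = Res_4 (F_1(p; v), F_2(p; v), F_3(p; v), u_0 v_0 + ⋯ + u_3 v_3)`,
the resultant being taken with respect to `v`; a polynomial in `u` (outer variables) whose
coefficients are polynomials in `p` (inner variables). -/
def uResultant (f : MvPolynomial (Fin 4) ℂ) : MvPolynomial (Fin 4) (MvPolynomial (Fin 4) ℂ) :=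
  multiResultant ![1, 2, 3, 1]
    ![map C (derivForm 1 f), map C (derivForm 2 f), map C (derivForm 3 f), ∑ j, C (X j) * X j]

end

/-! ### Forms, specialization of coefficients and elimination -/

section General

variable {σ : Type} [Fintype σ] [DecidableEq σ]

/-! The resultant is chosen as a normalized generator of the elimination ideal, so the work is to
show that this ideal is principal in degrees `1, 2, 3, 1` and to compute the degree of its generator
in the last form.

Principality. Solving the equations on the chart `x_j = 1` for the coefficients of `x_j ^ d_i`
exhibits the ideal as the kernel of a map into a domain, so it is prime
(`eliminationIdeal_isPrime`). It is nonzero because it contains Macaulay determinants. It contains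
no nonzero polynomial free of the coefficient of `x_0 ^ 3` in the cubic: generically the other three
forms have a common zero with `x_0 ≠ 0`, and this coefficient can be adjusted so that the cubic
vanishes there too (`eq_zero_of_rename_mem_eliminationIdeal`). Over a factorial ring these facts
force a single generator.

Vanishing. By the Nullstellensatz and a Macaulay determinant, the generator vanishes on a system
exactly when the system has a nontrivial common zero (`evalCoeffs_generator_eq_zero_iff`).

Degree six. The generator divides a Macaulay determinant of degree at most six in the last form,
hence is homogeneous of some degree at most six in it. A pencil of last forms on which it has six
roots without vanishing identically gives the reverse bound
(`universalResultant_isWeightedHomogeneous`). Homogeneity in `u` follows, and `K` is the total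
degree of the universal resultant.

Infinitely many directions. `U(p; u) = 0` means that some flex direction `v` satisfies `u · v = 0`.
Finitely many directions can be avoided by a suitable `u`; if there are infinitely many, `U(p; ·)`
acquires infinitely many zeros on a line, which is impossible if it is nonzero at a point of that
line. -/

lemma mem_univ_finsuppAntidiag_iff {m : σ →₀ ℕ} {n : ℕ} :
    m ∈ (Finset.univ : Finset σ).finsuppAntidiag n ↔ m.degree = n := by
  simp [Finset.mem_finsuppAntidiag, Finsupp.degree_eq_sum]

/-- A form of degree `n` is the sum of its terms over the monomials of degree `n`. -/
lemma sum_monomial_coeff_of_isHomogeneous {R : Type*} [CommRing R] {n : ℕ} {p : MvPolynomial σ R}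
    (hp : p.IsHomogeneous n) :
    ∑ m : {m : σ →₀ ℕ // m ∈ (Finset.univ : Finset σ).finsuppAntidiag n},
      monomial m.1 (coeff m.1 p) = p := by
  ext k
  rw [coeff_sum]
  simp only [coeff_monomial]
  by_cases hk : k.degree = n
  · rw [Finset.sum_eq_single ⟨k, mem_univ_finsuppAntidiag_iff.2 hk⟩]
    · simp
    · intro b _ hb
      rw [if_neg]
      intro h
      exact hb (Subtype.ext h)
    · simp
  · rw [hp.coeff_eq_zero hk]
    refine Finset.sum_eq_zero fun m _ => if_neg ?_
    rintro rfl
    exact hk (mem_univ_finsuppAntidiag_iff.1 m.2)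

lemma universalForm_isHomogeneous (d : σ → ℕ) (i : σ) : (universalForm d i).IsHomogeneous (d i) :=
  IsHomogeneous.sum _ _ _ fun m _ =>
    isHomogeneous_monomial _ (mem_univ_finsuppAntidiag_iff.1 m.2)

lemma map_universalForm (d : σ → ℕ) {R : Type} [CommRing R] [Algebra ℂ R] (G : σ → MvPolynomial σ R)
    (i : σ) (hG : (G i).IsHomogeneous (d i)) :
    map (evalCoeffs d G : MvPolynomial (CoeffIndex d) ℂ →+* R) (universalForm d i) = G i := by
  rw [universalForm, map_sum]
  conv_rhs => rw [← sum_monomial_coeff_of_isHomogeneous hG]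
  refine Finset.sum_congr rfl fun m _ => ?_
  rw [map_monomial]
  simp [evalCoeffs]

/-- Substituting the coefficients of `G` and evaluating at `v` kills the ideal of the universal
forms, so `v_j ^ N * a(G) = 0`; pick `j` with `v_j ≠ 0` and cancel. -/
lemma evalCoeffs_eq_zero_of_mem {d : σ → ℕ} {R : Type} [CommRing R] [IsDomain R] [Algebra ℂ R]
    {G : σ → MvPolynomial σ R} (hG : ∀ i, (G i).IsHomogeneous (d i)) {v : σ → R} (hv : v ≠ 0)
    (h0 : ∀ i, eval v (G i) = 0) {a : MvPolynomial (CoeffIndex d) ℂ} (ha : a ∈ eliminationIdeal d) :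
    evalCoeffs d G a = 0 := by
  obtain ⟨j, hj⟩ := Function.ne_iff.1 hv
  obtain ⟨N, hN⟩ := ha j
  let ψ : MvPolynomial σ (MvPolynomial (CoeffIndex d) ℂ) →+* R :=
    (eval v).comp (map (evalCoeffs d G : MvPolynomial (CoeffIndex d) ℂ →+* R))
  have hle : Ideal.span (Set.range (universalForm d)) ≤ RingHom.ker ψ := by
    rw [Ideal.span_le]
    rintro _ ⟨i, rfl⟩
    simp [ψ, map_universalForm d G i (hG i), h0 i, RingHom.mem_ker]
  have h := hle hN
  rw [RingHom.mem_ker] at h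
  simp only [ψ, RingHom.comp_apply, map_mul, map_pow, map_X, eval_X, map_C, eval_C] at h
  exact (mul_eq_zero.1 h).resolve_left (pow_ne_zero _ hj)

/-! ### Macaulay determinants -/

/-- The combination of the universal forms with cofactors `h i`. -/
noncomputable def universalCombination (d : σ → ℕ) (h : σ → MvPolynomial σ ℂ) :
    MvPolynomial σ (MvPolynomial (CoeffIndex d) ℂ) :=
  ∑ i, map C (h i) * universalForm d i

/-- The coefficient matrix of combinations of the universal forms, indexed by the monomials of
degree `N`. -/
noncomputable def macaulayMatrix (d : σ → ℕ) (N : ℕ)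
    (h : {m : σ →₀ ℕ // m ∈ (Finset.univ : Finset σ).finsuppAntidiag N} → σ → MvPolynomial σ ℂ) :
    Matrix {m : σ →₀ ℕ // m ∈ (Finset.univ : Finset σ).finsuppAntidiag N}
      {m : σ →₀ ℕ // m ∈ (Finset.univ : Finset σ).finsuppAntidiag N}
      (MvPolynomial (CoeffIndex d) ℂ) :=
  Matrix.of fun m m' => coeff m'.1 (universalCombination d (h m))

variable {d : σ → ℕ} {N : ℕ}
  {h : {m : σ →₀ ℕ // m ∈ (Finset.univ : Finset σ).finsuppAntidiag N} → σ → MvPolynomial σ ℂ}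

/-- By the adjugate identity, the determinant times any monomial of degree `N`, in particular `x_j ^
N`, is a combination of the rows, which lie in the ideal of the universal forms. -/
lemma det_macaulayMatrix_mem_eliminationIdeal
    (hh : ∀ m, (universalCombination d (h m)).IsHomogeneous N) :
    (macaulayMatrix d N h).det ∈ eliminationIdeal d := by
  set M := macaulayMatrix d N h with hM
  have key : ∀ k, C (M.det) * monomial k.1 1 =
      ∑ m, C (M.adjugate k m) * universalCombination d (h m) := by
    intro k
    calc C (M.det) * monomial k.1 1
        = ∑ m', C ((M.adjugate * M) k m') * monomial m'.1 1 := by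
          rw [Matrix.adjugate_mul, Finset.sum_eq_single k]
          · simp
          · intro b _ hb
            simp [Matrix.one_apply_ne hb.symm]
          · simp
      _ = ∑ m', ∑ m, C (M.adjugate k m) * (monomial m'.1 (M m m')) := by
          refine Finset.sum_congr rfl fun m' _ => ?_
          rw [Matrix.mul_apply, map_sum, Finset.sum_mul]
          refine Finset.sum_congr rfl fun m _ => ?_
          rw [C_mul, mul_assoc, C_mul_monomial, mul_one]
      _ = _ := by
          rw [Finset.sum_comm]
          refine Finset.sum_congr rfl fun m _ => ?_
          rw [← Finset.mul_sum]
          congr 1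
          exact sum_monomial_coeff_of_isHomogeneous (hh m)
  intro j
  refine ⟨N, ?_⟩
  have := key ⟨Finsupp.single j N, mem_univ_finsuppAntidiag_iff.2 (by simp)⟩
  rw [X_pow_eq_monomial, mul_comm, this]
  refine sum_mem fun m _ => Ideal.mul_mem_left _ _ ?_
  exact sum_mem fun i _ => Ideal.mul_mem_left _ _ (Ideal.subset_span ⟨i, rfl⟩)

/-- The cofactors are chosen for `G`, so the matrix specializes to the identity. -/
lemma evalCoeffs_det_macaulayMatrix_eq_one {G : σ → MvPolynomial σ ℂ}
    (hG : ∀ i, (G i).IsHomogeneous (d i)) (hh : ∀ m, ∑ i, h m i * G i = monomial m.1 1) :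
    evalCoeffs d G (macaulayMatrix d N h).det = 1 := by
  rw [AlgHom.map_det]
  suffices h0 : (evalCoeffs d G).mapMatrix (macaulayMatrix d N h) = 1 by rw [h0, Matrix.det_one]
  ext m m'
  have h1 : map (evalCoeffs d G : MvPolynomial (CoeffIndex d) ℂ →+* ℂ)
      (universalCombination d (h m)) = monomial m.1 1 := by
    rw [← hh m, universalCombination, map_sum]
    refine Finset.sum_congr rfl fun i _ => ?_
    rw [map_mul, map_universalForm d G i (hG i), map_map]
    congr 1
    convert map_id _
    exact RingHom.ext fun x => (evalCoeffs d G).commutes x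
  have h2 := congrArg (coeff m'.1) h1
  rw [coeff_map, coeff_monomial] at h2
  simp only [AlgHom.mapMatrix_apply, Matrix.map_apply, macaulayMatrix, Matrix.of_apply]
  refine h2.trans ?_
  rw [Matrix.one_apply]
  exact if_congr Subtype.ext_iff.symm rfl rfl

/-- Elimination: forms without nontrivial common zero do not annihilate the elimination ideal. -/
lemma exists_mem_eliminationIdeal_evalCoeffs_eq_one {G : σ → MvPolynomial σ ℂ}
    (hG : ∀ i, (G i).IsHomogeneous (d i)) (h0 : ∀ v : σ → ℂ, (∀ i, eval v (G i) = 0) → v = 0) :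
    ∃ a ∈ eliminationIdeal d, evalCoeffs d G a = 1 := by
  classical
  set J := Ideal.span (Set.range G) with hJ
  -- Nullstellensatz: the zero locus of `J` lies in the origin.
  have hrad : Ideal.span (Set.range (X : σ → MvPolynomial σ ℂ)) ≤ J.radical := by
    rw [Ideal.span_le]
    rintro _ ⟨j, rfl⟩
    rw [SetLike.mem_coe, ← vanishingIdeal_zeroLocus_eq_radical (K := ℂ)]
    intro v hv
    have : v = 0 := h0 v fun i => hv _ (Ideal.subset_span ⟨i, rfl⟩)
    simp [this]
  obtain ⟨n, hn⟩ := Ideal.exists_pow_le_of_le_radical_of_fg hrad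
    ⟨Finset.univ.image X, by simp⟩
  -- The summand `∑ i, d i` ensures `d i ≤ N`, so that the subtraction `N - d i` below is exact.
  set N := n + ∑ i, d i with hN
  have hmem : ∀ m : {m : σ →₀ ℕ // m ∈ (Finset.univ : Finset σ).finsuppAntidiag N},
      ∃ c : σ → MvPolynomial σ ℂ, ∑ i, c i * G i = monomial m.1 1 := by
    intro m
    have h1 : monomial m.1 (1 : ℂ) ∈ J := by
      refine hn ?_
      refine Ideal.pow_le_pow_right (Nat.le_add_right n (∑ i, d i)) ?_
      have hm := mem_univ_finsuppAntidiag_iff.1 m.2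
      suffices h2 : monomial m.1 (1 : ℂ) ∈ Ideal.span (Set.range X) ^ m.1.degree by
        rwa [hm] at h2
      rw [monomial_eq, C_1, one_mul, Finsupp.prod_fintype _ _ (by simp),
        Finsupp.degree_eq_sum, ← Finset.prod_pow_eq_pow_sum]
      exact Ideal.prod_mem_prod fun i _ =>
        Ideal.pow_mem_pow (Ideal.subset_span (Set.mem_range_self i)) _
    exact (Ideal.mem_span_range_iff_exists_fun).1 h1
  choose c hc using hmem
  have hle : ∀ i, d i ≤ N := fun i =>
    (Finset.single_le_sum (fun _ _ => Nat.zero_le _) (Finset.mem_univ i)).trans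
      (Nat.le_add_left _ _)
  refine ⟨_, det_macaulayMatrix_mem_eliminationIdeal (d := d) (N := N)
    (h := fun m i => homogeneousComponent (N - d i) (c m i)) ?_,
    evalCoeffs_det_macaulayMatrix_eq_one hG ?_⟩
  · intro m
    refine IsHomogeneous.sum _ _ _ fun i _ => ?_
    have := ((homogeneousComponent_isHomogeneous (N - d i) (c m i)).map
      (C : ℂ →+* MvPolynomial (CoeffIndex d) ℂ)).mul (universalForm_isHomogeneous d i)
    rwa [Nat.sub_add_cancel (hle i)] at this
  · intro m
    -- Only the component of degree `N - d i` of a cofactor contributes in degree `N`, so the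
    -- cofactors may be replaced by these components.
    have h1 : ∀ i, homogeneousComponent (N - d i) (c m i) * G i =
        homogeneousComponent N (c m i * G i) := by
      intro i
      conv_rhs => rw [← sum_homogeneousComponent (c m i), Finset.sum_mul, map_sum]
      have h2 : ∀ k, homogeneousComponent N (homogeneousComponent k (c m i) * G i) =
          if N - d i = k then homogeneousComponent k (c m i) * G i else 0 := by
        intro k
        rw [homogeneousComponent_of_mem
          ((homogeneousComponent_isHomogeneous k (c m i)).mul (hG i))]
        have := hle i
        congr 1
        simp only [eq_iff_iff]
        omega
      simp only [h2]
      rw [Finset.sum_ite_eq]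
      split_ifs with h3
      · rfl
      · rw [homogeneousComponent_eq_zero, zero_mul]
        simp only [Finset.mem_range, not_lt] at h3
        omega
    simp only [h1]
    rw [← map_sum, hc m, homogeneousComponent_of_mem
      (isHomogeneous_monomial _ (mem_univ_finsuppAntidiag_iff.1 m.2)), if_pos rfl]

lemma evalCoeffs_generator_eq_zero_iff {r : MvPolynomial (CoeffIndex d) ℂ}
    (hr : eliminationIdeal d = Ideal.span {r}) {G : σ → MvPolynomial σ ℂ}
    (hG : ∀ i, (G i).IsHomogeneous (d i)) :
    evalCoeffs d G r = 0 ↔ ∃ v : σ → ℂ, v ≠ 0 ∧ ∀ i, eval v (G i) = 0 := by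
  constructor
  · intro h0
    by_contra! hcon
    obtain ⟨a, ha, ha1⟩ := exists_mem_eliminationIdeal_evalCoeffs_eq_one hG fun v hv => by
      by_contra hne
      obtain ⟨i, hi⟩ := hcon v hne
      exact hi (hv i)
    rw [hr, Ideal.mem_span_singleton] at ha
    obtain ⟨s, rfl⟩ := ha
    rw [map_mul, h0, zero_mul] at ha1
    exact zero_ne_one ha1
  · rintro ⟨v, hv, hv0⟩
    exact evalCoeffs_eq_zero_of_mem hG hv hv0 (hr ▸ Ideal.mem_span_singleton_self r)

end General

/-! ### Principality of prime ideals of height one -/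

/-- A nonzero prime ideal of `R[X]`, `R` a factorial domain, which contains no nonzero constant is
principal. -/
lemma Polynomial.exists_eq_span_singleton_of_forall_C_mem {R : Type*} [CommRing R] [IsDomain R]
    [UniqueFactorizationMonoid R] (P : Ideal (Polynomial R)) [hP : P.IsPrime] (hne : P ≠ ⊥)
    (h : ∀ c : R, Polynomial.C c ∈ P → c = 0) : ∃ r, P = Ideal.span {r} := by
  obtain ⟨r₀, ⟨hr₀P, hr₀⟩, hmin₀⟩ := exists_minimalFor_of_wellFoundedLT
    (fun a : Polynomial R => a ∈ P ∧ a ≠ 0) Polynomial.natDegree (Submodule.exists_mem_ne_zero_of_ne_bot hne)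
  -- A prime factor of an element of minimal degree again lies in `P` and again has minimal degree.
  obtain ⟨r, hrP, hr, hdvd⟩ : ∃ r ∈ P, Prime r ∧ r ∣ r₀ := by
    obtain ⟨f, hf, hfr⟩ := UniqueFactorizationMonoid.exists_prime_factors r₀ hr₀
    have : f.prod ∈ P := by
      obtain ⟨u, hu⟩ := hfr.symm
      rw [← hu]
      exact Ideal.mul_mem_right _ _ hr₀P
    obtain ⟨r, hrf, hrP⟩ := (hP.multiset_prod_mem_iff_exists_mem f).1 this
    exact ⟨r, hrP, hf r hrf, (Multiset.dvd_prod hrf).trans hfr.dvd⟩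
  have hmin : ∀ a ∈ P, a ≠ 0 → r.natDegree ≤ a.natDegree := fun a ha ha0 =>
    (Polynomial.natDegree_le_of_dvd hdvd hr₀).trans
      (le_of_not_gt fun hlt => hlt.not_ge (hmin₀ ⟨ha, ha0⟩ hlt.le))
  have hdeg : 0 < r.natDegree := by
    rw [Nat.pos_iff_ne_zero]
    intro h0
    rw [Polynomial.eq_C_of_natDegree_eq_zero h0] at hrP hr
    exact hr.ne_zero (by rw [h _ hrP, map_zero])
  have key : ∀ n, ∀ a ∈ P, a.natDegree < n → ∃ c : R, c ≠ 0 ∧ r ∣ Polynomial.C c * a := by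
    intro n
    induction n with
    | zero => intro a _ h; omega
    | succ n ih =>
      intro a ha hn
      by_cases ha0 : a = 0
      · exact ⟨1, one_ne_zero, by simp [ha0]⟩
      have hle := hmin a ha ha0
      set b := Polynomial.C r.leadingCoeff * a -
        Polynomial.C a.leadingCoeff * Polynomial.X ^ (a.natDegree - r.natDegree) * r with hb
      have hbP : b ∈ P := sub_mem (Ideal.mul_mem_left _ _ ha) (Ideal.mul_mem_left _ _ hrP)
      have hrl : r.leadingCoeff ≠ 0 := Polynomial.leadingCoeff_ne_zero.2 hr.ne_zero
      have hal : a.leadingCoeff ≠ 0 := Polynomial.leadingCoeff_ne_zero.2 ha0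
      have hbn : b.natDegree < n := by
        have h1 : b.natDegree ≤ a.natDegree := by
          refine (Polynomial.natDegree_sub_le _ _).trans (max_le ?_ ?_)
          · exact Polynomial.natDegree_C_mul_le _ _
          · rw [mul_assoc]
            refine (Polynomial.natDegree_C_mul_le _ _).trans ?_
            refine Polynomial.natDegree_mul_le.trans ?_
            rw [Polynomial.natDegree_X_pow]
            omega
        have h2 : b.coeff a.natDegree = 0 := by
          have h3 : (Polynomial.X ^ (a.natDegree - r.natDegree) * r).coeff a.natDegree
              = r.leadingCoeff := by
            conv_lhs => rw [← Nat.sub_add_cancel hle]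
            rw [add_comm, Nat.add_sub_cancel_left, Polynomial.coeff_X_pow_mul]
            rfl
          rw [hb, Polynomial.coeff_sub, mul_assoc, Polynomial.coeff_C_mul, Polynomial.coeff_C_mul,
            h3, Polynomial.coeff_natDegree, mul_comm, sub_self]
        by_contra hcon
        have h4 : b.natDegree = a.natDegree := by omega
        rw [← h4, Polynomial.coeff_natDegree, Polynomial.leadingCoeff_eq_zero] at h2
        rw [h2, Polynomial.natDegree_zero] at h4
        omega
      obtain ⟨c, hc, hcb⟩ := ih b hbP hbn
      refine ⟨c * r.leadingCoeff, mul_ne_zero hc hrl, ?_⟩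
      have h5 : Polynomial.C (c * r.leadingCoeff) * a = Polynomial.C c * b + Polynomial.C c *
          (Polynomial.C a.leadingCoeff * Polynomial.X ^ (a.natDegree - r.natDegree)) * r := by
        rw [hb, Polynomial.C_mul]; ring
      rw [h5]
      exact dvd_add hcb (dvd_mul_left _ _)
  refine ⟨r, le_antisymm (fun a ha => ?_) ?_⟩
  · obtain ⟨c, hc, hca⟩ := key _ a ha (Nat.lt_succ_self _)
    rw [Ideal.mem_span_singleton]
    -- The prime `r` has positive degree, so it cannot divide the nonzero constant `c`.
    refine (hr.dvd_or_dvd hca).resolve_left fun hrc => ?_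
    have := Polynomial.natDegree_le_of_dvd hrc (by simpa using hc)
    rw [Polynomial.natDegree_C] at this
    omega
  · rwa [Ideal.span_singleton_le_iff_mem]

/-- Singling out the variable `i` turns the ring into polynomials in one variable over a factorial
ring, whose constants are the polynomials free of `i`. -/
lemma MvPolynomial.exists_eq_span_singleton_of_forall_rename_mem {τ k : Type*} [DecidableEq τ]
    [Field k] (i : τ) (P : Ideal (MvPolynomial τ k)) [hP : P.IsPrime] (hne : P ≠ ⊥)
    (h : ∀ b : MvPolynomial {x // x ≠ i} k, rename Subtype.val b ∈ P → b = 0) :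
    ∃ r, P = Ideal.span {r} := by
  let e : MvPolynomial τ k ≃ₐ[k] Polynomial (MvPolynomial {x // x ≠ i} k) :=
    (renameEquiv k (Equiv.optionSubtypeNe i).symm).trans (optionEquivLeft k _)
  let g : Polynomial (MvPolynomial {x // x ≠ i} k) →+* MvPolynomial τ k := e.symm
  have hg : ∀ b, g (Polynomial.C b) = rename Subtype.val b := by
    intro b
    suffices h1 : Polynomial.C b = e (rename Subtype.val b) by
      rw [h1]
      exact e.symm_apply_apply _
    simp only [e, AlgEquiv.trans_apply, renameEquiv_apply, rename_rename]
    induction b using MvPolynomial.induction_on with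
    | C a => simp [optionEquivLeft_C]
    | add p q hp hq => simp only [map_add, hp, hq]
    | mul_X p x hp =>
      simp only [map_mul, hp, rename_X, Function.comp_apply]
      congr 1
      rw [Equiv.optionSubtypeNe_symm_of_ne x.2]
      simp [optionEquivLeft_X_some]
  have hg' : ∀ a, g (e a) = a := fun a => e.symm_apply_apply a
  have hprime : (P.comap g).IsPrime := Ideal.IsPrime.comap g
  obtain ⟨r, hr⟩ := Polynomial.exists_eq_span_singleton_of_forall_C_mem (P.comap g)
    (by
      intro hbot
      obtain ⟨a, ha, ha0⟩ := Submodule.exists_mem_ne_zero_of_ne_bot hne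
      have : e a ∈ P.comap g := by
        rw [Ideal.mem_comap, hg']
        exact ha
      rw [hbot, Ideal.mem_bot] at this
      exact ha0 (by simpa using this))
    (fun c hc => h c (by rwa [Ideal.mem_comap, hg] at hc))
  refine ⟨g r, ?_⟩
  ext a
  have h1 : a ∈ P ↔ e a ∈ P.comap g := by rw [Ideal.mem_comap, hg']
  rw [h1, hr, Ideal.mem_span_singleton, Ideal.mem_span_singleton]
  constructor
  · intro hd
    have := map_dvd g hd
    rwa [hg'] at this
  · intro hd
    have := map_dvd e hd
    have h2 : e (g r) = r := e.apply_symm_apply r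
    rwa [h2] at this

/-! ### Weighted homogeneous polynomials -/

section Weighted

variable {τ R : Type*} [CommRing R]

/-- Scaling every variable by a power of an indeterminate, according to the weights. -/
noncomputable def weightScaling (w : τ → ℕ) :
    MvPolynomial τ R →ₐ[R] Polynomial (MvPolynomial τ R) :=
  aeval fun i => Polynomial.C (X i) * Polynomial.X ^ w i

lemma weightScaling_monomial (w : τ → ℕ) (m : τ →₀ ℕ) (c : R) :
    weightScaling w (monomial m c) = Polynomial.monomial (Finsupp.weight w m) (monomial m c) := by
  rw [weightScaling, aeval_monomial, ← Polynomial.C_mul_X_pow_eq_monomial, monomial_eq,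
    Finsupp.weight_apply, Polynomial.C_mul, mul_assoc]
  congr 1
  simp only [Finsupp.prod, Finsupp.sum, map_prod, mul_pow, Finset.prod_mul_distrib, map_pow,
    ← pow_mul, ← Finset.prod_pow_eq_pow_sum, smul_eq_mul]
  congr 2
  funext i
  rw [mul_comm]

lemma coeff_weightScaling (w : τ → ℕ) (p : MvPolynomial τ R) (n : ℕ) :
    (weightScaling w p).coeff n = weightedHomogeneousComponent w n p := by
  induction p using MvPolynomial.induction_on' with
  | monomial m c =>
    classical
    rw [weightScaling_monomial, Polynomial.coeff_monomial,
      weightedHomogeneousComponent_of_mem (isWeightedHomogeneous_monomial w m c rfl)]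
    simp [eq_comm]
  | add p q hp hq => rw [map_add, Polynomial.coeff_add, hp, hq, map_add]

/-- A factor of a nonzero weighted homogeneous polynomial is weighted homogeneous. -/
lemma MvPolynomial.IsWeightedHomogeneous.exists_of_mul [IsDomain R] {w : τ → ℕ}
    {r s : MvPolynomial τ R} {n : ℕ} (h : IsWeightedHomogeneous w (r * s) n) (h0 : r * s ≠ 0) :
    ∃ k ≤ n, IsWeightedHomogeneous w r k := by
  have hcoeff : ∀ p : MvPolynomial τ R, ∀ k, IsWeightedHomogeneous w p k →
      weightScaling w p = Polynomial.monomial k p := by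
    intro p k hp
    ext1 j
    rw [coeff_weightScaling, Polynomial.coeff_monomial, weightedHomogeneousComponent_of_mem hp]
    simp [eq_comm]
  have hinj : ∀ p : MvPolynomial τ R, weightScaling w p = 0 → p = 0 := by
    intro p hp
    rw [← sum_weightedHomogeneousComponent w p]
    refine finsum_eq_zero_of_forall_eq_zero fun k => ?_
    rw [← coeff_weightScaling, hp, Polynomial.coeff_zero]
  have hr : weightScaling w r ≠ 0 := fun h1 => h0 (by rw [hinj r h1, zero_mul])
  have hs : weightScaling w s ≠ 0 := fun h1 => h0 (by rw [hinj s h1, mul_zero])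
  have hm := hcoeff _ _ h
  rw [map_mul] at hm
  -- The scaled product is a monomial in the scaling variable. Degree and trailing degree are both
  -- additive over a domain, so they agree on each factor.
  have h1 := Polynomial.natDegree_mul hr hs
  have h2 := Polynomial.natTrailingDegree_mul hr hs
  rw [hm, Polynomial.natDegree_monomial_eq _ h0] at h1
  rw [hm, Polynomial.natTrailingDegree_monomial h0] at h2
  have h3 := Polynomial.natTrailingDegree_le_natDegree (weightScaling w r)
  have h4 := Polynomial.natTrailingDegree_le_natDegree (weightScaling w s)
  set k := (weightScaling w r).natDegree with hk
  refine ⟨k, by omega, ?_⟩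
  have h5 : weightedHomogeneousComponent w k r = r := by
    conv_rhs => rw [← sum_weightedHomogeneousComponent w r]
    rw [finsum_eq_single _ k]
    intro j hj
    rw [← coeff_weightScaling]
    rcases lt_or_gt_of_ne hj with hj | hj
    · exact Polynomial.coeff_eq_zero_of_lt_natTrailingDegree (by omega)
    · exact Polynomial.coeff_eq_zero_of_natDegree_lt (by omega)
  rw [← h5]
  exact weightedHomogeneousComponent_isWeightedHomogeneous k r

lemma MvPolynomial.IsWeightedHomogeneous.isHomogeneous_aeval {ρ S : Type*} [CommRing S]
    [Algebra R S] {w : τ → ℕ} {p : MvPolynomial τ R} {n : ℕ} (hp : IsWeightedHomogeneous w p n)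
    {g : τ → MvPolynomial ρ S} (hg : ∀ i, (g i).IsHomogeneous (w i)) :
    (aeval g p).IsHomogeneous n := by
  rw [aeval_def, eval₂_eq]
  refine IsHomogeneous.sum _ _ _ fun m hm => ?_
  rw [IsScalarTower.algebraMap_apply R S (MvPolynomial ρ S), algebraMap_eq]
  refine IsHomogeneous.C_mul ?_ _
  rw [← hp (mem_support_iff.1 hm), Finsupp.weight_apply, Finsupp.sum]
  refine IsHomogeneous.prod _ _ _ fun i _ => ?_
  rw [smul_eq_mul, mul_comm]
  exact (hg i).pow _

lemma MvPolynomial.IsWeightedHomogeneous.natDegree_aeval_le {w : τ → ℕ} {p : MvPolynomial τ R}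
    {n : ℕ} (hp : IsWeightedHomogeneous w p n) {g : τ → Polynomial R}
    (hg : ∀ i, (g i).natDegree ≤ w i) : (aeval g p).natDegree ≤ n := by
  rw [aeval_def, eval₂_eq]
  refine Polynomial.natDegree_sum_le_of_forall_le _ _ fun m hm => ?_
  refine (Polynomial.natDegree_C_mul_le _ _).trans ?_
  rw [← hp (mem_support_iff.1 hm), Finsupp.weight_apply, Finsupp.sum]
  refine (Polynomial.natDegree_prod_le _ _).trans (Finset.sum_le_sum fun i _ => ?_)
  rw [smul_eq_mul]
  exact Polynomial.natDegree_pow_le_of_le _ (hg i)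

end Weighted

lemma MvPolynomial.IsHomogeneous.eval₂_mul_left {τ R S : Type*} [CommRing R] [CommRing S]
    {p : MvPolynomial τ R} {n : ℕ} (hp : p.IsHomogeneous n) (f : R →+* S) (s : S) (g : τ → S) :
    MvPolynomial.eval₂ f (fun k => s * g k) p = s ^ n * MvPolynomial.eval₂ f g p := by
  rw [eval₂_eq, eval₂_eq, Finset.mul_sum]
  refine Finset.sum_congr rfl fun m hm => ?_
  simp only [mul_pow, Finset.prod_mul_distrib, Finset.prod_pow_eq_pow_sum]
  rw [show ∑ i ∈ m.support, m i = n from hp.degree_eq_sum_deg_support hm |>.symm]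
  ring

/-- Modulo an ideal, an element can be inverted at the cost of its power torsion. -/
lemma exists_ringHom_inverting {P : Type} [CommRing P] (I : Ideal P) (x : P) :
    ∃ (S : Type) (_ : CommRing S) (can : P →+* S) (inv : S), can x * inv = 1 ∧
      (∀ p ∈ I, can p = 0) ∧ ∀ p, can p = 0 → ∃ N : ℕ, x ^ N * p ∈ I := by
  refine ⟨Localization.Away (Ideal.Quotient.mk I x), inferInstance,
    (algebraMap (P ⧸ I) _).comp (Ideal.Quotient.mk I),
    IsLocalization.Away.invSelf (Ideal.Quotient.mk I x),
    IsLocalization.Away.mul_invSelf (Ideal.Quotient.mk I x), fun p hp => ?_, fun p hp => ?_⟩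
  · rw [RingHom.comp_apply, Ideal.Quotient.eq_zero_iff_mem.2 hp, map_zero]
  · rw [RingHom.comp_apply, ← map_zero (algebraMap (P ⧸ I) _)] at hp
    obtain ⟨N, hN⟩ := IsLocalization.Away.exists_of_eq (Ideal.Quotient.mk I x) hp
    refine ⟨N, ?_⟩
    rw [mul_zero, ← map_pow, ← map_mul] at hN
    exact Ideal.Quotient.eq_zero_iff_mem.1 hN

/-! ### Primality of the elimination ideal -/

section EliminationPrime

variable {σ : Type} [Fintype σ] [DecidableEq σ]

/-- The variables, with the `j`-th one set to `1`. -/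
noncomputable def affineVars (d : σ → ℕ) (j : σ) :
    σ → MvPolynomial σ (MvPolynomial (CoeffIndex d) ℂ) :=
  Function.update X j 1

/-- Solving the equations `F_i = 0` on the chart `x_j = 1` for the coefficients of `x_j ^ d_i`. -/
noncomputable def solveCoeffs (d : σ → ℕ) (j : σ) :
    MvPolynomial (CoeffIndex d) ℂ →ₐ[ℂ] MvPolynomial σ (MvPolynomial (CoeffIndex d) ℂ) :=
  aeval fun im => if im.2.1 = Finsupp.single j (d im.1) then
    C (X im) - eval₂ C (affineVars d j) (universalForm d im.1) else C (X im)

/-- The extension of `solveCoeffs` to the variables `x_k`, sending `x_j` to `1`. -/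
noncomputable def solveHom (d : σ → ℕ) (j : σ) :
    MvPolynomial σ (MvPolynomial (CoeffIndex d) ℂ) →+*
      MvPolynomial σ (MvPolynomial (CoeffIndex d) ℂ) :=
  eval₂Hom (solveCoeffs d j : _ →+* _) (affineVars d j)

lemma solveHom_C (d : σ → ℕ) (j : σ) (a : MvPolynomial (CoeffIndex d) ℂ) :
    solveHom d j (C a) = solveCoeffs d j a := by simp [solveHom]

/-- The coefficient of `x_j ^ d_i` was corrected by exactly the dehomogenized form, so everything
cancels. -/
lemma solveHom_universalForm (d : σ → ℕ) (j i : σ) : solveHom d j (universalForm d i) = 0 := by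
  have hprod : ∀ m : σ →₀ ℕ, m = Finsupp.single j (d i) →
      (m.prod fun k e => affineVars d j k ^ e) = 1 := by
    rintro _ rfl
    exact (Finsupp.prod_single_index (h := fun k e => affineVars d j k ^ e) (pow_zero _)).trans
      (by simp [affineVars])
  have h1 : solveHom d j (universalForm d i) =
      ∑ m : {m : σ →₀ ℕ // m ∈ (Finset.univ : Finset σ).finsuppAntidiag (d i)},
        (C (X ⟨i, m⟩) * (m.1.prod fun k e => affineVars d j k ^ e) -
          if m.1 = Finsupp.single j (d i) then
            eval₂ C (affineVars d j) (universalForm d i) else 0) := by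
    conv_lhs => rw [universalForm, map_sum]
    refine Finset.sum_congr rfl fun m _ => ?_
    rw [solveHom, coe_eval₂Hom, eval₂_monomial, RingHom.coe_coe, solveCoeffs, aeval_X]
    dsimp only
    split_ifs with h
    · rw [hprod _ h, mul_one, mul_one]
    · rw [sub_zero]
  have h2 : (∑ m : {m : σ →₀ ℕ // m ∈ (Finset.univ : Finset σ).finsuppAntidiag (d i)},
      if m.1 = Finsupp.single j (d i) then
        eval₂ C (affineVars d j) (universalForm d i) else 0) =
      eval₂ C (affineVars d j) (universalForm d i) := by
    rw [Finset.sum_eq_single ⟨Finsupp.single j (d i), mem_univ_finsuppAntidiag_iff.2 (by simp)⟩]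
    · exact if_pos rfl
    · intro b _ hb
      exact if_neg fun h => hb (Subtype.ext h)
    · simp
  rw [h1, Finset.sum_sub_distrib, sub_eq_zero, h2, universalForm, eval₂_sum]
  exact Finset.sum_congr rfl fun m _ => (eval₂_monomial _ _).symm

/-- Modulo the forms and with `x_j` inverted, `x_k ↦ x_k / x_j` kills the dehomogenized forms. There
the correction made by `solveCoeffs` disappears, so `a` itself becomes zero, i.e. is killed by a
power of `x_j` modulo the ideal. -/
lemma exists_X_pow_mul_mem_of_solveCoeffs_eq_zero {d : σ → ℕ} {j : σ}
    {a : MvPolynomial (CoeffIndex d) ℂ} (ha : solveCoeffs d j a = 0) :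
    ∃ N : ℕ, X j ^ N * C a ∈ Ideal.span (Set.range (universalForm d)) := by
  set I := Ideal.span (Set.range (universalForm d)) with hI
  obtain ⟨S, _, can, inv, hinv, hcanI, hker⟩ := exists_ringHom_inverting I (X j)
  let η : MvPolynomial σ (MvPolynomial (CoeffIndex d) ℂ) →+* S :=
    eval₂Hom (can.comp C) fun k => inv * can (X k)
  have hF : ∀ i, η (eval₂ C (affineVars d j) (universalForm d i)) = 0 := by
    intro i
    have h1 : η (eval₂ C (affineVars d j) (universalForm d i)) =
        eval₂ (can.comp C) (fun k => inv * can (X k)) (universalForm d i) := by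
      rw [hom_eval₂]
      congr 1
      · ext <;> simp [η]
      · funext k
        by_cases hk : k = j
        · subst hk
          rw [mul_comm, hinv]
          simp [affineVars]
        · simp [affineVars, hk, η]
    rw [h1, (universalForm_isHomogeneous d i).eval₂_mul_left]
    have h2 : eval₂ (can.comp C) (fun k => can (X k)) (universalForm d i) =
        can (universalForm d i) := by
      have := hom_eval₂ (universalForm d i) C can X
      rw [eval₂_eta] at this
      exact this.symm
    rw [h2, hcanI _ (Ideal.subset_span (Set.mem_range_self i)), mul_zero]
  have hcomp : η.comp (solveCoeffs d j : _ →+* _) = can.comp C := by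
    apply MvPolynomial.ringHom_ext
    · intro c
      have : solveCoeffs d j (C c) = C (C c) := (solveCoeffs d j).commutes c
      rw [RingHom.comp_apply, RingHom.coe_coe, this]
      simp [η]
    · intro im
      rw [RingHom.comp_apply, RingHom.coe_coe, solveCoeffs, aeval_X]
      split_ifs
      · rw [map_sub, hF, sub_zero]
        simp [η]
      · simp [η]
  have h0 : can (C a) = 0 := by
    have := RingHom.congr_fun hcomp a
    rw [RingHom.comp_apply, RingHom.coe_coe, ha, map_zero] at this
    exact this.symm
  exact hker _ h0

lemma solveHom_eq_zero_of_mem {d : σ → ℕ} {p : MvPolynomial σ (MvPolynomial (CoeffIndex d) ℂ)}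
    (hp : p ∈ Ideal.span (Set.range (universalForm d))) (j : σ) : solveHom d j p = 0 := by
  have hle : Ideal.span (Set.range (universalForm d)) ≤ RingHom.ker (solveHom d j) := by
    rw [Ideal.span_le]
    rintro _ ⟨i, rfl⟩
    exact solveHom_universalForm d j i
  exact hle hp

/-- One chart suffices: `solveHom` lands in a domain and sends every variable to a nonzero element,
so torsion for one variable gives vanishing on every chart. -/
lemma mem_eliminationIdeal_iff_solveCoeffs {d : σ → ℕ} (j : σ)
    {a : MvPolynomial (CoeffIndex d) ℂ} : a ∈ eliminationIdeal d ↔ solveCoeffs d j a = 0 := by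
  have hmul : ∀ {k l : σ} {N : ℕ}, X l ^ N * C a ∈ Ideal.span (Set.range (universalForm d)) →
      solveCoeffs d k a = 0 := by
    intro k l N h
    have h1 := solveHom_eq_zero_of_mem h k
    rw [map_mul, map_pow, solveHom_C] at h1
    refine (mul_eq_zero.1 h1).resolve_left (pow_ne_zero _ ?_)
    rw [solveHom, coe_eval₂Hom, eval₂_X, affineVars]
    by_cases hl : l = k
    · simp [hl]
    · simp [hl, X_ne_zero]
  constructor
  · intro ha
    exact hmul (ha j).choose_spec
  · intro ha k
    obtain ⟨N, hN⟩ := exists_X_pow_mul_mem_of_solveCoeffs_eq_zero ha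
    exact exists_X_pow_mul_mem_of_solveCoeffs_eq_zero (hmul hN)

lemma eliminationIdeal_isPrime [Nonempty σ] (d : σ → ℕ) : (eliminationIdeal d).IsPrime := by
  obtain ⟨j⟩ := ‹Nonempty σ›
  have : eliminationIdeal d = RingHom.ker (solveCoeffs d j) := by
    ext a
    rw [mem_eliminationIdeal_iff_solveCoeffs j, RingHom.mem_ker]
  rw [this]
  exact RingHom.ker_isPrime _

end EliminationPrime

/-! ### Specialization and weights of the universal coefficients -/

section UniversalCoefficients

variable {σ : Type} [Fintype σ] [DecidableEq σ]

lemma coeff_universalForm (d : σ → ℕ) (i : σ) (k : σ →₀ ℕ) :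
    coeff k (universalForm d i) =
      if h : k ∈ (Finset.univ : Finset σ).finsuppAntidiag (d i) then X ⟨i, ⟨k, h⟩⟩ else 0 := by
  rw [universalForm, coeff_sum]
  simp only [coeff_monomial]
  split_ifs with h
  · rw [Finset.sum_eq_single ⟨k, h⟩]
    · exact if_pos rfl
    · intro b _ hb
      exact if_neg fun h => hb (Subtype.ext h)
    · simp
  · refine Finset.sum_eq_zero fun m _ => if_neg ?_
    rintro rfl
    exact h m.2

lemma evalCoeffs_map_eval_universalForm (d : σ → ℕ) (c : CoeffIndex d → ℂ)
    (a : MvPolynomial (CoeffIndex d) ℂ) :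
    evalCoeffs d (fun i => map (eval c) (universalForm d i)) a = eval c a := by
  have h : (fun im : CoeffIndex d => coeff im.2.1 (map (eval c) (universalForm d im.1))) = c := by
    funext im
    rw [coeff_map, coeff_universalForm, dif_pos im.2.2, eval_X]
  rw [evalCoeffs, h, aeval_eq_eval]

lemma eval_map_universalForm (d : σ → ℕ) (c : CoeffIndex d → ℂ) (i : σ) (v : σ → ℂ) :
    eval v (map (eval c) (universalForm d i)) =
      ∑ m : {m : σ →₀ ℕ // m ∈ (Finset.univ : Finset σ).finsuppAntidiag (d i)},
        c ⟨i, m⟩ * m.1.prod fun k e => v k ^ e := by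
  simp [universalForm, map_sum, eval_monomial]

lemma MvPolynomial.ringHom_eval {τ R S : Type*} [CommRing R] [CommRing S] (f : R →+* S) (v : τ → R)
    (p : MvPolynomial τ R) : f (eval v p) = eval (fun i => f (v i)) (map f p) := by
  rw [eval_map, eval, coe_eval₂Hom, hom_eval₂]
  rfl

lemma ringHom_evalCoeffs (d : σ → ℕ) {R S : Type} [CommRing R] [CommRing S] [Algebra ℂ R]
    [Algebra ℂ S] (f : R →ₐ[ℂ] S) (G : σ → MvPolynomial σ R)
    (a : MvPolynomial (CoeffIndex d) ℂ) :
    f (evalCoeffs d G a) = evalCoeffs d (fun i => map (f : R →+* S) (G i)) a := by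
  rw [evalCoeffs, evalCoeffs, ← AlgHom.comp_apply, comp_aeval]
  simp only [coeff_map]
  rfl

/-- Weights on the coefficients of the universal forms, depending only on the form. -/
def formWeight (d : σ → ℕ) (ω : σ → ℕ) (im : CoeffIndex d) : ℕ := ω im.1

lemma isWeightedHomogeneous_coeff_universalForm (d : σ → ℕ) (ω : σ → ℕ) (i : σ) (k : σ →₀ ℕ) :
    IsWeightedHomogeneous (formWeight d ω) (coeff k (universalForm d i)) (ω i) := by
  rw [coeff_universalForm]
  split_ifs with h
  · exact isWeightedHomogeneous_X ℂ (formWeight d ω) ⟨i, ⟨k, h⟩⟩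
  · exact isWeightedHomogeneous_zero _ _ _

lemma Matrix.det_isWeightedHomogeneous {n τ R : Type*} [Fintype n] [DecidableEq n] [CommRing R]
    {w : τ → ℕ} {M : Matrix n n (MvPolynomial τ R)} {ρ : n → ℕ}
    (hM : ∀ i j, IsWeightedHomogeneous w (M i j) (ρ i)) :
    IsWeightedHomogeneous w M.det (∑ i, ρ i) := by
  rw [Matrix.det_apply]
  refine IsWeightedHomogeneous.sum _ _ _ fun π _ => ?_
  have h1 : IsWeightedHomogeneous w (∏ i, M (π i) i) (∑ i, ρ i) := by
    rw [← Equiv.sum_comp π ρ]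
    exact IsWeightedHomogeneous.prod _ _ _ fun i _ => hM (π i) i
  rcases Int.units_eq_one_or (Equiv.Perm.sign π) with h | h
  · rw [h, one_smul]
    exact h1
  · rw [h, Units.neg_smul, one_smul]
    exact h1.neg

variable {d : σ → ℕ} {N : ℕ}

/-- If every monomial `m` of degree `N` is divisible by the power `x_i ^ d_i`, `i = s m`, then
the elimination ideal contains a determinant whose weight counts the occurrences of the forms. -/
lemma exists_mem_eliminationIdeal_isWeightedHomogeneous
    (s : {m : σ →₀ ℕ // m ∈ (Finset.univ : Finset σ).finsuppAntidiag N} → σ)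
    (hs : ∀ m, d (s m) ≤ m.1 (s m)) (ω : σ → ℕ) :
    ∃ a ∈ eliminationIdeal d, evalCoeffs d (fun i => (X i : MvPolynomial σ ℂ) ^ d i) a = 1 ∧
      IsWeightedHomogeneous (formWeight d ω) a (∑ m, ω (s m)) := by
  -- Row `m` is the form `s m` times `x ^ m / x_i ^ d_i`, `i = s m`; at the pure powers this is `x ^
  -- m` itself.
  let h : {m : σ →₀ ℕ // m ∈ (Finset.univ : Finset σ).finsuppAntidiag N} → σ → MvPolynomial σ ℂ :=
    fun m i => if i = s m then monomial (m.1 - Finsupp.single (s m) (d (s m))) 1 else 0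
  have hle : ∀ m, Finsupp.single (s m) (d (s m)) ≤ m.1 := fun m => by
    rw [Finsupp.single_le_iff]
    exact hs m
  have hcomb : ∀ m, universalCombination d (h m) =
      monomial (m.1 - Finsupp.single (s m) (d (s m))) 1 * universalForm d (s m) := by
    intro m
    rw [universalCombination, Finset.sum_eq_single (s m)]
    · simp [h]
    · intro i _ hi
      simp [h, hi]
    · simp
  have hdeg : ∀ m : {m : σ →₀ ℕ // m ∈ (Finset.univ : Finset σ).finsuppAntidiag N},
      (m.1 - Finsupp.single (s m) (d (s m))).degree + d (s m) = N := by
    intro m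
    have h1 := congrArg Finsupp.degree (tsub_add_cancel_of_le (hle m))
    rw [map_add, Finsupp.degree_single] at h1
    rw [h1]
    exact mem_univ_finsuppAntidiag_iff.1 m.2
  refine ⟨(macaulayMatrix d N h).det, det_macaulayMatrix_mem_eliminationIdeal fun m => ?_,
    evalCoeffs_det_macaulayMatrix_eq_one (fun i => ?_) fun m => ?_,
    Matrix.det_isWeightedHomogeneous fun m m' => ?_⟩
  · rw [hcomb]
    have := (isHomogeneous_monomial (1 : MvPolynomial (CoeffIndex d) ℂ)
      (d := m.1 - Finsupp.single (s m) (d (s m))) rfl).mul (universalForm_isHomogeneous d (s m))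
    rwa [hdeg m] at this
  · exact isHomogeneous_X_pow i (d i)
  · rw [Finset.sum_eq_single (s m)]
    · simp only [h, if_true]
      rw [X_pow_eq_monomial, monomial_mul, tsub_add_cancel_of_le (hle m), one_mul]
    · intro i _ hi
      simp [h, hi]
    · simp
  · rw [macaulayMatrix, Matrix.of_apply, hcomb, coeff_monomial_mul']
    split_ifs
    · rw [one_mul]
      exact isWeightedHomogeneous_coeff_universalForm d ω (s m) _
    · exact isWeightedHomogeneous_zero _ _ _

end UniversalCoefficients

/-! ### Lines meeting hypersurfaces -/

lemma MvPolynomial.IsHomogeneous.eval_eq_sum_single {τ R : Type*} [Fintype τ] [DecidableEq τ]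
    [CommRing R] {p : MvPolynomial τ R} (hp : p.IsHomogeneous 1) (v : τ → R) :
    eval v p = ∑ j, v j * eval (Pi.single j 1) p := by
  have h : p ∈ Submodule.span R (Set.range (X : τ → MvPolynomial τ R)) := by
    rw [← homogeneousSubmodule_one_eq_span_X]
    exact hp
  clear hp
  induction h using Submodule.span_induction with
  | mem x hx =>
    obtain ⟨i, rfl⟩ := hx
    simp [Pi.single_apply]
  | zero => simp
  | add x y _ _ hx hy => simp [hx, hy, mul_add, Finset.sum_add_distrib]
  | smul a x _ hx => simp [hx, Finset.mul_sum, mul_left_comm]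

/-- A form which does not vanish at `Q` vanishes somewhere on the line through `P` and `Q` outside
of `Q`. -/
lemma MvPolynomial.IsHomogeneous.exists_eval_line_eq_zero {τ : Type*}
    {F : MvPolynomial τ ℂ} {n : ℕ} (hF : F.IsHomogeneous n) (hn : n ≠ 0) (P Q : τ → ℂ)
    (hQ : eval Q F ≠ 0) : ∃ t : ℂ, eval (fun k => P k + t * Q k) F = 0 := by
  set p : Polynomial ℂ := MvPolynomial.aeval (fun k => Polynomial.C (P k) + Polynomial.X * Polynomial.C (Q k)) F
    with hp
  set q : Polynomial ℂ := MvPolynomial.aeval (fun k => Polynomial.X * Polynomial.C (P k) + Polynomial.C (Q k)) F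
    with hq
  have hpe : ∀ t, p.eval t = eval (fun k => P k + t * Q k) F := by
    intro t
    rw [hp, ← Polynomial.coe_evalRingHom, aeval_def, hom_eval₂]
    simp only [eval, coe_eval₂Hom]
    congr 1
    · ext; simp
    · funext k; simpa using mul_comm _ _
  have hqe : ∀ t, q.eval t = eval (fun k => t * P k + Q k) F := by
    intro t
    rw [hq, ← Polynomial.coe_evalRingHom, aeval_def, hom_eval₂]
    simp only [eval, coe_eval₂Hom]
    congr 1
    · ext; simp
    · funext k; simpa using mul_comm _ _
  -- Without roots `p` is a constant `c`. Since `q(s) = s ^ n * p(1 / s)`, this gives `q = c * X ^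
  -- n`, so `F(Q) = q(0) = 0`.
  by_contra! hcon
  have hdeg : p.degree ≤ 0 := by
    by_contra hd
    obtain ⟨t, ht⟩ := IsAlgClosed.exists_root p (fun h => hd h.le)
    exact hcon t (by rw [← hpe]; exact ht)
  obtain ⟨c, hc⟩ : ∃ c, p = Polynomial.C c := ⟨_, Polynomial.eq_C_of_degree_le_zero hdeg⟩
  have h1 : q - Polynomial.C c * Polynomial.X ^ n = 0 := by
    refine Polynomial.eq_zero_of_infinite_isRoot _ ((Set.finite_singleton (0 : ℂ)).infinite_compl.mono ?_)
    intro s hs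
    have hs : s ≠ 0 := hs
    have h2 : eval (fun k => s * P k + Q k) F = s ^ n * eval (fun k => P k + s⁻¹ * Q k) F := by
      have := hF.eval₂_mul_left (RingHom.id ℂ) s (fun k => P k + s⁻¹ * Q k)
      rw [eval, coe_eval₂Hom, eval, coe_eval₂Hom, ← this]
      congr 1
      funext k
      field_simp
    change Polynomial.eval s _ = 0
    rw [Polynomial.eval_sub, hqe, h2, ← hpe, hc, Polynomial.eval_C, Polynomial.eval_mul,
      Polynomial.eval_C, Polynomial.eval_pow, Polynomial.eval_X]
    ring
  apply hQ
  have h3 := hqe 0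
  rw [sub_eq_zero.1 h1] at h3
  simpa [hn] using h3.symm

/-! ### The resultant in degrees `1, 2, 3, 1` -/

/-- The coefficient of `x_0 ^ 3` in the cubic form. -/
noncomputable def cubicCoeffIndex : CoeffIndex ![1, 2, 3, 1] :=
  ⟨2, ⟨Finsupp.single 0 3, mem_univ_finsuppAntidiag_iff.2 (by simp)⟩⟩

lemma eval_universalForm_update_cubicCoeff (c : CoeffIndex ![1, 2, 3, 1] → ℂ) (t : ℂ) (i : Fin 4)
    (v : Fin 4 → ℂ) :
    eval v (map (eval (Function.update c cubicCoeffIndex t)) (universalForm ![1, 2, 3, 1] i)) =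
      eval v (map (eval c) (universalForm ![1, 2, 3, 1] i)) +
        if i = 2 then (t - c cubicCoeffIndex) * v 0 ^ 3 else 0 := by
  rw [eval_map_universalForm, eval_map_universalForm]
  split_ifs with hi
  · subst hi
    rw [← sub_eq_iff_eq_add', ← Finset.sum_sub_distrib, Finset.sum_eq_single
      (⟨Finsupp.single 0 3, mem_univ_finsuppAntidiag_iff.2 (by simp)⟩ : {m : Fin 4 →₀ ℕ //
        m ∈ (Finset.univ : Finset (Fin 4)).finsuppAntidiag ((![1, 2, 3, 1] : Fin 4 → ℕ) 2)})]
    · have h2 : ((Finsupp.single 0 3 : Fin 4 →₀ ℕ).prod fun k e => v k ^ e) = v 0 ^ 3 :=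
        Finsupp.prod_single_index (h := fun k e => v k ^ e) (pow_zero _)
      change Function.update c cubicCoeffIndex t cubicCoeffIndex * _ - c cubicCoeffIndex * _ = _
      rw [Function.update_self, h2]
      ring
    · intro b _ hb
      rw [Function.update_of_ne, sub_self]
      rintro h
      exact hb (eq_of_heq (Sigma.mk.inj h).2)
    · exact fun h => absurd (Finset.mem_univ _) h
  · rw [add_zero]
    refine Finset.sum_congr rfl fun m _ => ?_
    rw [Function.update_of_ne]
    rintro h
    exact hi (congrArg Sigma.fst h)

/-- Coefficients of the first linear form. -/
noncomputable def firstLinearCoeff (j : Fin 4) : MvPolynomial (CoeffIndex ![1, 2, 3, 1]) ℂ :=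
  eval (Pi.single j 1) (universalForm ![1, 2, 3, 1] 0)

/-- Coefficients of the last linear form. -/
noncomputable def lastLinearCoeff (j : Fin 4) : MvPolynomial (CoeffIndex ![1, 2, 3, 1]) ℂ :=
  eval (Pi.single j 1) (universalForm ![1, 2, 3, 1] 3)

/-- The point with `x_0 = 0` on the line `∑ a_j x_j = ∑ b_j x_j = 0`. -/
def lineInfinity {R : Type*} [CommRing R] (a b : Fin 4 → R) : Fin 4 → R :=
  ![0, a 2 * b 3 - a 3 * b 2, a 3 * b 1 - a 1 * b 3, a 1 * b 2 - a 2 * b 1]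

/-- The point with `x_3 = 0` on the line `∑ a_j x_j = ∑ b_j x_j = 0`. -/
def lineOrigin {R : Type*} [CommRing R] (a b : Fin 4 → R) : Fin 4 → R :=
  ![a 1 * b 2 - a 2 * b 1, a 2 * b 0 - a 0 * b 2, a 0 * b 1 - a 1 * b 0, 0]

/-- A polynomial in the coefficients whose nonvanishing ensures that the common zeros of the two
linear forms and the quadratic form lie in the chart `x_0 ≠ 0`. -/
noncomputable def chartDiscriminant : MvPolynomial (CoeffIndex ![1, 2, 3, 1]) ℂ :=
  (firstLinearCoeff 1 * lastLinearCoeff 2 - firstLinearCoeff 2 * lastLinearCoeff 1) *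
    eval (lineInfinity firstLinearCoeff lastLinearCoeff) (universalForm ![1, 2, 3, 1] 1)

lemma ringHom_chartDiscriminant {S : Type*} [CommRing S]
    (f : MvPolynomial (CoeffIndex ![1, 2, 3, 1]) ℂ →+* S) (a b : Fin 4 → S)
    (ha : ∀ j, a j = eval (Pi.single j 1) (map f (universalForm ![1, 2, 3, 1] 0)))
    (hb : ∀ j, b j = eval (Pi.single j 1) (map f (universalForm ![1, 2, 3, 1] 3))) :
    f chartDiscriminant = (a 1 * b 2 - a 2 * b 1) *
      eval (lineInfinity a b) (map f (universalForm ![1, 2, 3, 1] 1)) := by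
  have hsingle : ∀ j : Fin 4, (fun i => f ((Pi.single j 1 : Fin 4 → _) i)) = Pi.single j 1 := by
    intro j
    funext i
    by_cases h : i = j
    · subst h; simp
    · simp [h]
  have ha' : ∀ j, f (firstLinearCoeff j) = a j := by
    intro j
    rw [firstLinearCoeff, ringHom_eval, ha, hsingle]
  have hb' : ∀ j, f (lastLinearCoeff j) = b j := by
    intro j
    rw [lastLinearCoeff, ringHom_eval, hb, hsingle]
  rw [chartDiscriminant, map_mul, map_sub, map_mul, map_mul, ringHom_eval]
  simp only [ha', hb']
  congr 2
  congr 1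
  funext i
  fin_cases i <;> simp [lineInfinity, ha', hb']

lemma chartDiscriminant_ne_zero : chartDiscriminant ≠ 0 := by
  intro h0
  -- Here the line is `x_1 = x_2 = 0` and its point at infinity is `(0, 0, 0, 1)`, where `x_3 ^ 2`
  -- does not vanish.
  let G : Fin 4 → MvPolynomial (Fin 4) ℂ := ![X 1, X 3 ^ 2, X 0 ^ 3, X 2]
  have hG : ∀ i, (G i).IsHomogeneous ((![1, 2, 3, 1] : Fin 4 → ℕ) i) := by
    intro i
    fin_cases i
    · exact isHomogeneous_X _ _
    · exact isHomogeneous_X_pow _ _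
    · exact isHomogeneous_X_pow _ _
    · exact isHomogeneous_X _ _
  have h1 := ringHom_chartDiscriminant (evalCoeffs ![1, 2, 3, 1] G : _ →+* ℂ)
    (Pi.single 1 1) (Pi.single 2 1)
    (fun j => by
      rw [map_universalForm _ _ _ (hG 0)]
      simp [G, Pi.single_apply, eq_comm])
    (fun j => by
      rw [map_universalForm _ _ _ (hG 3)]
      simp [G, Pi.single_apply, eq_comm])
  rw [h0, map_zero, map_universalForm _ _ _ (hG 1)] at h1
  simp [G, lineInfinity] at h1

/-- The quadric is nonzero at the point at infinity of the line, so it meets the line elsewhere, at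
`lineOrigin + t * lineInfinity`. The coordinate `x_0` of that point is the nonzero minor. -/
lemma exists_commonZero_of_chartDiscriminant_ne_zero {c : CoeffIndex ![1, 2, 3, 1] → ℂ}
    (hc : eval c chartDiscriminant ≠ 0) : ∃ v : Fin 4 → ℂ, v 0 ≠ 0 ∧ ∀ i : Fin 4, i ≠ 2 →
      eval v (map (eval c) (universalForm ![1, 2, 3, 1] i)) = 0 := by
  set a : Fin 4 → ℂ := fun j =>
    eval (Pi.single j 1) (map (eval c) (universalForm ![1, 2, 3, 1] 0)) with ha
  set b : Fin 4 → ℂ := fun j =>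
    eval (Pi.single j 1) (map (eval c) (universalForm ![1, 2, 3, 1] 3)) with hb
  rw [ringHom_chartDiscriminant (eval c) a b (fun _ => rfl) (fun _ => rfl)] at hc
  obtain ⟨t, ht⟩ := ((universalForm_isHomogeneous ![1, 2, 3, 1] 1).map (eval c)).exists_eval_line_eq_zero
    (by simp) (lineOrigin a b) (lineInfinity a b) (right_ne_zero_of_mul hc)
  refine ⟨fun k => lineOrigin a b k + t * lineInfinity a b k, ?_, fun i hi => ?_⟩
  · simpa [lineOrigin, lineInfinity] using left_ne_zero_of_mul hc
  · fin_cases i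
    · refine (((universalForm_isHomogeneous ![1, 2, 3, 1] 0).map (eval c)).eval_eq_sum_single _).trans ?_
      change ∑ j, _ * a j = 0
      simp only [Fin.sum_univ_four, lineOrigin, lineInfinity]
      simp
      ring
    · exact ht
    · exact absurd rfl hi
    · refine (((universalForm_isHomogeneous ![1, 2, 3, 1] 3).map (eval c)).eval_eq_sum_single _).trans ?_
      change ∑ j, _ * b j = 0
      simp only [Fin.sum_univ_four, lineOrigin, lineInfinity]
      simp
      ring

lemma eq_zero_of_rename_mem_eliminationIdeal
    {b : MvPolynomial {x // x ≠ cubicCoeffIndex} ℂ}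
    (hb : rename Subtype.val b ∈ eliminationIdeal ![1, 2, 3, 1]) : b = 0 := by
  -- Multiplying by the discriminant reduces the claim to generic coefficient vectors.
  have h : rename Subtype.val b * chartDiscriminant = 0 := by
    refine MvPolynomial.funext fun c => ?_
    rw [map_mul, map_zero]
    by_cases hc : eval c chartDiscriminant = 0
    · rw [hc, mul_zero]
    obtain ⟨v, hv, hv0⟩ := exists_commonZero_of_chartDiscriminant_ne_zero hc
    -- The value of the free coefficient that makes the cubic vanish at `v`; changing it does not
    -- affect `b`.
    set t := c cubicCoeffIndex -
      eval v (map (eval c) (universalForm ![1, 2, 3, 1] 2)) / v 0 ^ 3 with ht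
    have h1 := evalCoeffs_eq_zero_of_mem (d := ![1, 2, 3, 1])
      (G := fun i => map (eval (Function.update c cubicCoeffIndex t))
        (universalForm ![1, 2, 3, 1] i))
      (fun i => (universalForm_isHomogeneous _ i).map _) (v := v)
      (fun h0 => hv (by rw [h0]; rfl))
      (fun i => by
        rw [eval_universalForm_update_cubicCoeff]
        split_ifs with hi
        · subst hi
          rw [ht]
          field_simp
          ring
        · rw [hv0 i hi, add_zero]) hb
    rw [evalCoeffs_map_eval_universalForm, eval_rename] at h1
    have h2 : (Function.update c cubicCoeffIndex t ∘ Subtype.val :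
        {x // x ≠ cubicCoeffIndex} → ℂ) = c ∘ Subtype.val := by
      funext x
      exact Function.update_of_ne x.2 _ _
    rw [eval_rename, ← h2, h1, zero_mul]
  rcases mul_eq_zero.1 h with h | h
  · exact rename_injective _ Subtype.val_injective (by rw [h, map_zero])
  · exact absurd h chartDiscriminant_ne_zero

/-- The choice of dividing powers in Macaulay's determinant for degrees `1, 2, 3, 1`. -/
lemma exists_mem_eliminationIdeal_degree_six :
    ∃ a ∈ eliminationIdeal ![1, 2, 3, 1],
      evalCoeffs ![1, 2, 3, 1]
        (fun i => (X i : MvPolynomial (Fin 4) ℂ) ^ (![1, 2, 3, 1] : Fin 4 → ℕ) i) a = 1 ∧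
      ∃ n ≤ 6, IsWeightedHomogeneous (formWeight ![1, 2, 3, 1] ![0, 0, 0, 1]) a n := by
  -- The degree `4 = ∑ (d_i - 1) + 1` is where every monomial is divisible by some `x_i ^ d_i`; the
  -- last form is used only when no other choice is possible.
  let s : {m : Fin 4 →₀ ℕ // m ∈ (Finset.univ : Finset (Fin 4)).finsuppAntidiag 4} → Fin 4 :=
    fun m => if 1 ≤ m.1 0 then 0 else if 2 ≤ m.1 1 then 1 else if 3 ≤ m.1 2 then 2 else 3
  have hsum : ∀ m : {m : Fin 4 →₀ ℕ // m ∈ (Finset.univ : Finset (Fin 4)).finsuppAntidiag 4},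
      m.1 0 + m.1 1 + m.1 2 + m.1 3 = 4 := by
    intro m
    have := mem_univ_finsuppAntidiag_iff.1 m.2
    rwa [Finsupp.degree_eq_sum, Fin.sum_univ_four] at this
  obtain ⟨a, ha, ha1, haw⟩ := exists_mem_eliminationIdeal_isWeightedHomogeneous
    (d := ![1, 2, 3, 1]) s (fun m => by
      have := hsum m
      simp only [s]
      split_ifs with h0 h1 h2
      · exact h0
      · exact h1
      · exact h2
      · change 1 ≤ m.1 3
        omega) ![0, 0, 0, 1]
  refine ⟨a, ha, ha1, _, ?_, haw⟩
  have hω : ∀ m, (![0, 0, 0, 1] : Fin 4 → ℕ) (s m) =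
      if m.1 0 = 0 ∧ m.1 1 < 2 ∧ m.1 2 < 3 then 1 else 0 := by
    intro m
    simp only [s]
    split_ifs <;> first | rfl | omega
  simp only [hω]
  rw [← Finset.card_filter]
  -- Rows using the last form have `x_0`-exponent `0`, `x_1`-exponent below `2` and `x_2`-exponent
  -- below `3`, and the `x_3`-exponent is then determined: at most `2 * 3` rows.
  refine (Finset.card_le_card_of_injOn (t := Finset.range 2 ×ˢ Finset.range 3)
    (fun m => (m.1 1, m.1 2)) ?_ ?_).trans (by simp)
  · intro m hm
    simp only [Finset.coe_filter, Finset.mem_univ, true_and, Set.mem_ofPred_eq] at hm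
    simp [hm.2.1, hm.2.2]
  · intro m hm m' hm' h
    simp only [Finset.coe_filter, Finset.mem_univ, true_and, Set.mem_ofPred_eq] at hm hm'
    rw [Prod.mk.injEq] at h
    have h1 := hsum m
    have h2 := hsum m'
    apply Subtype.ext
    ext i
    fin_cases i
    · exact hm.1.trans hm'.1.symm
    · exact h.1
    · exact h.2
    · change m.1 3 = m'.1 3
      omega

/-- A generator exists by principality. It divides a determinant with value `1` at the pure powers,
so its own value there is nonzero and can be scaled to `1`. -/
lemma universalResultant_spec :
    eliminationIdeal ![1, 2, 3, 1] = Ideal.span {universalResultant ![1, 2, 3, 1]} ∧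
      evalCoeffs ![1, 2, 3, 1]
        (fun i => (X i : MvPolynomial (Fin 4) ℂ) ^ (![1, 2, 3, 1] : Fin 4 → ℕ) i)
        (universalResultant ![1, 2, 3, 1]) = 1 := by
  refine Classical.epsilon_spec (p := fun r => eliminationIdeal ![1, 2, 3, 1] = Ideal.span {r} ∧
    evalCoeffs ![1, 2, 3, 1]
      (fun i => (X i : MvPolynomial (Fin 4) ℂ) ^ (![1, 2, 3, 1] : Fin 4 → ℕ) i) r = 1) ?_
  obtain ⟨a, ha, ha1, -⟩ := exists_mem_eliminationIdeal_degree_six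
  have hne : eliminationIdeal ![1, 2, 3, 1] ≠ ⊥ := by
    intro h
    rw [h, Ideal.mem_bot] at ha
    rw [ha, map_zero] at ha1
    exact zero_ne_one ha1
  have := eliminationIdeal_isPrime (![1, 2, 3, 1] : Fin 4 → ℕ)
  obtain ⟨r, hr⟩ := MvPolynomial.exists_eq_span_singleton_of_forall_rename_mem cubicCoeffIndex
    (eliminationIdeal ![1, 2, 3, 1]) hne fun _ => eq_zero_of_rename_mem_eliminationIdeal
  rw [hr, Ideal.mem_span_singleton] at ha
  obtain ⟨s, rfl⟩ := ha
  rw [map_mul] at ha1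
  set u := evalCoeffs ![1, 2, 3, 1]
    (fun i => (X i : MvPolynomial (Fin 4) ℂ) ^ (![1, 2, 3, 1] : Fin 4 → ℕ) i) r with hu
  have hu0 : u ≠ 0 := left_ne_zero_of_mul (ha1 ▸ one_ne_zero)
  refine ⟨C u⁻¹ * r, ?_, ?_⟩
  · rw [hr, eq_comm, Ideal.span_singleton_mul_left_unit]
    exact (IsUnit.mk0 _ (inv_ne_zero hu0)).map C
  · rw [map_mul, ← hu]
    have : evalCoeffs ![1, 2, 3, 1]
      (fun i => (X i : MvPolynomial (Fin 4) ℂ) ^ (![1, 2, 3, 1] : Fin 4 → ℕ) i) (C u⁻¹) = u⁻¹ :=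
      AlgHom.commutes _ _
    rw [this, inv_mul_cancel₀ hu0]

/-- Forms of degrees `1, 2, 3, 1`: the first three have six simple common zeros, and the last one
is a pencil of linear forms whose members `t = 0, …, 5` pass through one of them each. -/
noncomputable def pencilForms {R : Type} [CommRing R] (t : R) : Fin 4 → MvPolynomial (Fin 4) R :=
  ![X 0, X 1 * (X 1 - X 3), X 2 * (X 2 - X 3) * (X 2 - C 2 * X 3), C t * X 3 - C 3 * X 1 - X 2]

lemma pencilForms_isHomogeneous {R : Type} [CommRing R] (t : R) (i : Fin 4) :
    (pencilForms t i).IsHomogeneous ((![1, 2, 3, 1] : Fin 4 → ℕ) i) := by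
  have hX : ∀ j : Fin 4, (X j : MvPolynomial (Fin 4) R).IsHomogeneous 1 := isHomogeneous_X R
  fin_cases i
  · exact hX 0
  · exact (hX 1).mul ((hX 1).sub (hX 3))
  · exact ((hX 2).mul ((hX 2).sub (hX 3))).mul ((hX 2).sub ((hX 3).C_mul 2))
  · exact (((hX 3).C_mul t).sub ((hX 1).C_mul 3)).sub (hX 2)

lemma map_pencilForms {R S : Type} [CommRing R] [CommRing S] (f : R →+* S) (t : R) (i : Fin 4) :
    map f (pencilForms t i) = pencilForms (f t) i := by
  have h2 : f 2 = 2 := map_ofNat f 2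
  have h3 : f 3 = 3 := map_ofNat f 3
  fin_cases i <;> simp [pencilForms, h2, h3]

lemma evalCoeffs_pencilForms_eq_zero (n : Fin 6) :
    evalCoeffs ![1, 2, 3, 1] (pencilForms ((n : ℕ) : ℂ)) (universalResultant ![1, 2, 3, 1]) = 0 := by
  rw [evalCoeffs_generator_eq_zero_iff universalResultant_spec.1 (pencilForms_isHomogeneous _)]
  -- The six zeros are indexed by division with remainder: `n = 3 * (n / 3) + n % 3`.
  refine ⟨![0, ((n / 3 : ℕ) : ℂ), ((n % 3 : ℕ) : ℂ), 1], fun h => ?_, fun i => ?_⟩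
  · simpa using congrFun h 3
  · fin_cases n <;> fin_cases i <;> simp [pencilForms] <;> norm_num

lemma evalCoeffs_pencilForms_ne_zero :
    evalCoeffs ![1, 2, 3, 1] (pencilForms (7 : ℂ)) (universalResultant ![1, 2, 3, 1]) ≠ 0 := by
  rw [Ne, evalCoeffs_generator_eq_zero_iff universalResultant_spec.1 (pencilForms_isHomogeneous _)]
  rintro ⟨v, hv, h⟩
  apply hv
  have h0 := h 0
  have h1 := h 1
  have h2 := h 2
  have h3 := h 3
  simp only [pencilForms, Matrix.cons_val, map_mul, map_sub, eval_X, eval_C, mul_eq_zero,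
    sub_eq_zero] at h0 h1 h2 h3
  -- On the zeros of the first three forms `3 x_1 + x_2 = n x_3` with `n ≤ 5`, so the last form is
  -- `(7 - n) x_3` with nonzero factor.
  have hv3 : v 3 = 0 := by
    rcases h1 with h1 | h1 <;> rcases h2 with (h2 | h2) | h2 <;> rw [h1, h2] at h3
    · linear_combination h3 / 7
    · linear_combination h3 / 6
    · linear_combination h3 / 5
    · linear_combination h3 / 4
    · linear_combination h3 / 3
    · linear_combination h3 / 2
  have hv1 : v 1 = 0 := by rcases h1 with h1 | h1 <;> simp [h1, hv3]
  have hv2 : v 2 = 0 := by rcases h2 with (h2 | h2) | h2 <;> simp [h2, hv3]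
  funext i
  fin_cases i
  · exact h0
  · exact hv1
  · exact hv2
  · exact hv3

lemma natDegree_coeff_pencilForms_X_le (im : CoeffIndex ![1, 2, 3, 1]) :
    (coeff im.2.1 (pencilForms (Polynomial.X : Polynomial ℂ) im.1)).natDegree ≤
      formWeight ![1, 2, 3, 1] ![0, 0, 0, 1] im := by
  obtain ⟨i, m, hm⟩ := im
  have hconst : ∀ i : Fin 4, i ≠ 3 → pencilForms (Polynomial.X : Polynomial ℂ) i =
      map Polynomial.C (pencilForms (0 : ℂ) i) := by
    intro i hi
    rw [map_pencilForms]
    fin_cases i <;> simp [pencilForms] at hi ⊢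
  by_cases hi : i = 3
  · subst hi
    change (coeff m (C Polynomial.X * X 3 - C 3 * X 1 - X 2 :
      MvPolynomial (Fin 4) (Polynomial ℂ))).natDegree ≤ 1
    have hX : ∀ j : Fin 4, (coeff m (X j : MvPolynomial (Fin 4) (Polynomial ℂ))).natDegree = 0 := by
      intro j
      rw [coeff_X]
      split_ifs <;> simp
    rw [coeff_sub, coeff_sub, coeff_C_mul, coeff_C_mul]
    refine (Polynomial.natDegree_sub_le _ _).trans
      (max_le ((Polynomial.natDegree_sub_le _ _).trans (max_le ?_ ?_)) ?_)
    · refine Polynomial.natDegree_mul_le.trans ?_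
      rw [hX, Polynomial.natDegree_X]
    · refine Polynomial.natDegree_mul_le.trans ?_
      rw [hX, show (3 : Polynomial ℂ) = Polynomial.C 3 from rfl, Polynomial.natDegree_C]
      omega
    · rw [hX]
      omega
  · change (coeff m (pencilForms (Polynomial.X : Polynomial ℂ) i)).natDegree ≤ _
    rw [hconst i hi, coeff_map, Polynomial.natDegree_C]
    exact Nat.zero_le _

/-- The resultant in degrees `1, 2, 3, 1` has degree six in the coefficients of the last form. -/
theorem universalResultant_isWeightedHomogeneous :
    IsWeightedHomogeneous (formWeight ![1, 2, 3, 1] ![0, 0, 0, 1])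
      (universalResultant ![1, 2, 3, 1]) 6 := by
  obtain ⟨a, ha, ha1, n, hn, haw⟩ := exists_mem_eliminationIdeal_degree_six
  rw [universalResultant_spec.1, Ideal.mem_span_singleton] at ha
  obtain ⟨s, rfl⟩ := ha
  obtain ⟨k, hk, hkw⟩ := haw.exists_of_mul (by
    intro h0
    rw [h0, map_zero] at ha1
    exact zero_ne_one ha1)
  suffices h6 : 6 ≤ k by
    obtain rfl : k = 6 := by omega
    exact hkw
  by_contra hlt
  -- Along the pencil the generator is a polynomial of degree at most `k` in `t`; for `k < 6` the
  -- roots `0, …, 5` would force it to vanish, contradicting its value at `7`.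
  set q : Polynomial ℂ := evalCoeffs ![1, 2, 3, 1] (pencilForms Polynomial.X)
    (universalResultant ![1, 2, 3, 1]) with hq
  have hqe : ∀ t : ℂ, q.eval t = evalCoeffs ![1, 2, 3, 1] (pencilForms t)
      (universalResultant ![1, 2, 3, 1]) := by
    intro t
    have h1 := ringHom_evalCoeffs ![1, 2, 3, 1] (Polynomial.aeval t) (pencilForms Polynomial.X)
      (universalResultant ![1, 2, 3, 1])
    rw [← hq, Polynomial.coe_aeval_eq_eval] at h1
    rw [h1]
    congr 1
    congr 1
    funext i
    rw [map_pencilForms]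
    simp
  have hdeg : q.natDegree ≤ k := hkw.natDegree_aeval_le natDegree_coeff_pencilForms_X_le
  have hq0 : q = 0 := by
    refine Polynomial.eq_zero_of_natDegree_lt_card_of_eval_eq_zero q
      (f := fun n : Fin 6 => ((n : ℕ) : ℂ)) (fun m n h => ?_) (fun n => ?_) ?_
    · exact Fin.ext (Nat.cast_injective h)
    · rw [hqe]
      exact evalCoeffs_pencilForms_eq_zero n
    · rw [Fintype.card_fin]
      omega
  apply evalCoeffs_pencilForms_ne_zero
  rw [← hqe, hq0, Polynomial.eval_zero]

/-! ### Degrees in the point -/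

lemma MvPolynomial.totalDegree_pderiv_le {τ R : Type*} [CommRing R] (j : τ)
    (f : MvPolynomial τ R) : (pderiv j f).totalDegree ≤ f.totalDegree := by
  conv_lhs => rw [f.as_sum, map_sum]
  refine totalDegree_finsetSum_le fun m hm => ?_
  rw [pderiv_monomial]
  refine (totalDegree_monomial_le _ _).trans (le_trans ?_ (le_totalDegree hm))
  exact Finsupp.degree_mono tsub_le_self

/-- All coefficients of a polynomial with polynomial coefficients have total degree at most `n`. -/
def CoeffDegreeLE {τ ρ R : Type*} [CommRing R] (n : ℕ) (p : MvPolynomial τ (MvPolynomial ρ R)) :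
    Prop :=
  ∀ m, (coeff m p).totalDegree ≤ n

namespace CoeffDegreeLE

variable {τ ρ R : Type*} [CommRing R] {n k : ℕ} {p q : MvPolynomial τ (MvPolynomial ρ R)}

lemma mono (hp : CoeffDegreeLE n p) (h : n ≤ k) : CoeffDegreeLE k p := fun m => (hp m).trans h

lemma C_of_le {a : MvPolynomial ρ R} (ha : a.totalDegree ≤ n) :
    CoeffDegreeLE n (C a : MvPolynomial τ (MvPolynomial ρ R)) := by
  classical
  intro m
  rw [coeff_C]
  split_ifs
  · exact ha
  · simp

lemma X_of (i : τ) : CoeffDegreeLE 0 (X i : MvPolynomial τ (MvPolynomial ρ R)) := by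
  classical
  intro m
  rw [coeff_X]
  split_ifs <;> simp

lemma sum {ι : Type*} {s : Finset ι} {g : ι → MvPolynomial τ (MvPolynomial ρ R)}
    (hg : ∀ i ∈ s, CoeffDegreeLE n (g i)) : CoeffDegreeLE n (∑ i ∈ s, g i) := by
  intro m
  rw [coeff_sum]
  exact totalDegree_finsetSum_le fun i hi => hg i hi m

lemma mul (hp : CoeffDegreeLE n p) (hq : CoeffDegreeLE k q) : CoeffDegreeLE (n + k) (p * q) := by
  classical
  intro m
  rw [coeff_mul]
  exact totalDegree_finsetSum_le fun x _ =>
    (totalDegree_mul _ _).trans (add_le_add (hp x.1) (hq x.2))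

lemma pow (hp : CoeffDegreeLE n p) (e : ℕ) : CoeffDegreeLE (e * n) (p ^ e) := by
  induction e with
  | zero =>
    rw [pow_zero, zero_mul]
    exact C_of_le (a := 1) (by simp)
  | succ e ih =>
    rw [pow_succ, add_mul, one_mul]
    exact ih.mul hp

lemma prod {ι : Type*} {s : Finset ι} {g : ι → MvPolynomial τ (MvPolynomial ρ R)} {e : ι → ℕ}
    (hg : ∀ i ∈ s, CoeffDegreeLE (e i) (g i)) : CoeffDegreeLE (∑ i ∈ s, e i) (∏ i ∈ s, g i) := by
  classical
  induction s using Finset.induction_on with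
  | empty => exact C_of_le (a := 1) (by simp)
  | insert a s ha ih =>
    rw [Finset.sum_insert ha, Finset.prod_insert ha]
    exact (hg a (Finset.mem_insert_self a s)).mul
      (ih fun i hi => hg i (Finset.mem_insert_of_mem hi))

lemma aeval {ι : Type*} {g : ι → MvPolynomial τ (MvPolynomial ρ R)}
    (hg : ∀ i, CoeffDegreeLE n (g i)) (r : MvPolynomial ι R) :
    CoeffDegreeLE (r.totalDegree * n) (MvPolynomial.aeval g r) := by
  rw [aeval_def, eval₂_eq]
  refine sum fun m hm => ?_
  have h1 : CoeffDegreeLE (∑ i ∈ m.support, m i * n) (∏ i ∈ m.support, g i ^ m i) :=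
    prod fun i _ => (hg i).pow _
  rw [← Finset.sum_mul] at h1
  have h2 := (C_of_le (τ := τ) (n := 0) (a := (C (coeff m r) : MvPolynomial ρ R))
    (by rw [totalDegree_C])).mul h1
  rw [zero_add] at h2
  exact h2.mono (Nat.mul_le_mul_right n (le_totalDegree hm))

end CoeffDegreeLE

/-- Differentiation in `p` does not raise the degree; this crude bound suffices for a linear
estimate. -/
lemma derivForm_coeffDegreeLE (i : ℕ) {n : ℕ} (f : MvPolynomial (Fin 4) ℂ)
    (hf : f.totalDegree ≤ n) : CoeffDegreeLE n (derivForm i f) := by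
  induction i generalizing f with
  | zero => exact CoeffDegreeLE.C_of_le hf
  | succ i ih =>
    refine CoeffDegreeLE.sum fun j _ => ?_
    have := (CoeffDegreeLE.X_of j).mul (ih _ ((totalDegree_pderiv_le j f).trans hf))
    rwa [zero_add] at this

lemma derivForm_isHomogeneous (i : ℕ) (f : MvPolynomial (Fin 4) ℂ) :
    (derivForm i f).IsHomogeneous i := by
  induction i generalizing f with
  | zero => exact isHomogeneous_C _ _
  | succ i ih =>
    refine IsHomogeneous.sum _ _ _ fun j _ => ?_
    have := (isHomogeneous_X (MvPolynomial (Fin 4) ℂ) j).mul (ih (pderiv j f))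
    rwa [add_comm] at this

/-! ### The u-resultant -/

/-- The system of forms defining the u-resultant. -/
noncomputable def uForms (f : MvPolynomial (Fin 4) ℂ) :
    Fin 4 → MvPolynomial (Fin 4) (MvPolynomial (Fin 4) (MvPolynomial (Fin 4) ℂ)) :=
  ![map C (derivForm 1 f), map C (derivForm 2 f), map C (derivForm 3 f), ∑ j, C (X j) * X j]

lemma coeff_uForms_of_ne (f : MvPolynomial (Fin 4) ℂ) {i : Fin 4} (hi : i ≠ 3) (m : Fin 4 →₀ ℕ) :
    ∃ k, coeff m (uForms f i) = C (coeff m (derivForm k f)) := by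
  fin_cases i
  · exact ⟨1, coeff_map _ _ _⟩
  · exact ⟨2, coeff_map _ _ _⟩
  · exact ⟨3, coeff_map _ _ _⟩
  · exact absurd rfl hi

lemma coeff_uForms_last (f : MvPolynomial (Fin 4) ℂ) (m : Fin 4 →₀ ℕ) :
    coeff m (uForms f 3) = ∑ j, X j * if Finsupp.single j 1 = m then 1 else 0 := by
  change coeff m (∑ j, C (X j) * X j) = _
  rw [coeff_sum]
  refine Finset.sum_congr rfl fun j _ => ?_
  rw [coeff_C_mul, coeff_X]

/-- Only the last form involves `u`, and it does so linearly, which matches the weights `0, 0, 0,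
1`. -/
lemma uResultant_isHomogeneous (f : MvPolynomial (Fin 4) ℂ) : (uResultant f).IsHomogeneous 6 := by
  refine universalResultant_isWeightedHomogeneous.isHomogeneous_aeval fun im => ?_
  obtain ⟨i, m, hm⟩ := im
  change (coeff m (uForms f i)).IsHomogeneous ((![0, 0, 0, 1] : Fin 4 → ℕ) i)
  by_cases hi : i = 3
  · subst hi
    rw [coeff_uForms_last]
    refine IsHomogeneous.sum _ _ _ fun j _ => ?_
    split_ifs
    · rw [mul_one]
      exact isHomogeneous_X _ j
    · rw [mul_zero]
      exact isHomogeneous_zero _ _ _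
  · obtain ⟨k, hk⟩ := coeff_uForms_of_ne f hi m
    rw [hk, show (![0, 0, 0, 1] : Fin 4 → ℕ) i = 0 by fin_cases i <;> simp at hi ⊢]
    exact isHomogeneous_C _ _

lemma totalDegree_coeff_uResultant_le (f : MvPolynomial (Fin 4) ℂ) (m : Fin 4 →₀ ℕ) :
    (coeff m (uResultant f)).totalDegree ≤
      (universalResultant ![1, 2, 3, 1]).totalDegree * f.totalDegree := by
  refine CoeffDegreeLE.aeval (fun im => ?_) (universalResultant ![1, 2, 3, 1]) m
  obtain ⟨i, m, hm⟩ := im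
  change CoeffDegreeLE f.totalDegree (coeff m (uForms f i))
  by_cases hi : i = 3
  · subst hi
    rw [coeff_uForms_last]
    refine CoeffDegreeLE.sum fun j _ => ?_
    split_ifs
    · rw [mul_one]
      exact (CoeffDegreeLE.X_of j).mono (Nat.zero_le _)
    · rw [mul_zero]
      intro k
      simp
  · obtain ⟨k, hk⟩ := coeff_uForms_of_ne f hi m
    rw [hk]
    exact CoeffDegreeLE.C_of_le (derivForm_coeffDegreeLE k f le_rfl m)

/-- `v` is a nonzero direction in which the first three derivatives of `f` at `p` vanish. -/
def IsFlexDirection (f : MvPolynomial (Fin 4) ℂ) (p v : Fin 4 → ℂ) : Prop :=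
  v ≠ 0 ∧ ∀ i, 1 ≤ i → i ≤ 3 → eval v (map (eval p) (derivForm i f)) = 0

/-- The resultant commutes with specializing `p` and `u`, so the vanishing criterion over `ℂ`
applies to the specialized forms. -/
lemma eval_map_uResultant_eq_zero_iff (f : MvPolynomial (Fin 4) ℂ) (p u : Fin 4 → ℂ) :
    eval u (map (eval p) (uResultant f)) = 0 ↔
      ∃ v, IsFlexDirection f p v ∧ ∑ j, u j * v j = 0 := by
  let ψ : MvPolynomial (Fin 4) (MvPolynomial (Fin 4) ℂ) →ₐ[ℂ] ℂ :=
    { (eval u).comp (map (eval p)) with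
      commutes' := fun c => by simp [MvPolynomial.algebraMap_apply] }
  let G : Fin 4 → MvPolynomial (Fin 4) ℂ :=
    ![map (eval p) (derivForm 1 f), map (eval p) (derivForm 2 f), map (eval p) (derivForm 3 f),
      ∑ j, C (u j) * X j]
  have hψC : (ψ : MvPolynomial (Fin 4) (MvPolynomial (Fin 4) ℂ) →+* ℂ).comp C = eval p := by
    ext x
    · simp [ψ]
    · simp [ψ]
  have hψX : ∀ j, (ψ : MvPolynomial (Fin 4) (MvPolynomial (Fin 4) ℂ) →+* ℂ) (X j) = u j := by
    intro j
    simp [ψ]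
  have hψlast : map (ψ : MvPolynomial (Fin 4) (MvPolynomial (Fin 4) ℂ) →+* ℂ) (uForms f 3) =
      ∑ j, C (u j) * X j := by
    rw [show uForms f 3 = ∑ j, C (X j) * X j from rfl, map_sum]
    refine Finset.sum_congr rfl fun j _ => ?_
    rw [map_mul, map_C, map_X, hψX]
  have hψ : ∀ i, map (ψ : MvPolynomial (Fin 4) (MvPolynomial (Fin 4) ℂ) →+* ℂ) (uForms f i) = G i := by
    intro i
    fin_cases i
    · change map (ψ : MvPolynomial (Fin 4) (MvPolynomial (Fin 4) ℂ) →+* ℂ) (map C _) =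
        map (eval p) _
      rw [map_map, hψC]
    · change map (ψ : MvPolynomial (Fin 4) (MvPolynomial (Fin 4) ℂ) →+* ℂ) (map C _) =
        map (eval p) _
      rw [map_map, hψC]
    · change map (ψ : MvPolynomial (Fin 4) (MvPolynomial (Fin 4) ℂ) →+* ℂ) (map C _) =
        map (eval p) _
      rw [map_map, hψC]
    · exact hψlast
  have hG : ∀ i, (G i).IsHomogeneous ((![1, 2, 3, 1] : Fin 4 → ℕ) i) := by
    intro i
    fin_cases i
    · exact (derivForm_isHomogeneous 1 f).map _
    · exact (derivForm_isHomogeneous 2 f).map _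
    · exact (derivForm_isHomogeneous 3 f).map _
    · change (∑ j, C (u j) * X j : MvPolynomial (Fin 4) ℂ).IsHomogeneous 1
      exact IsHomogeneous.sum _ _ _ fun j _ => (isHomogeneous_X ℂ j).C_mul _
  have h1 : eval u (map (eval p) (uResultant f)) =
      evalCoeffs ![1, 2, 3, 1] G (universalResultant ![1, 2, 3, 1]) := by
    have := ringHom_evalCoeffs ![1, 2, 3, 1] ψ (uForms f) (universalResultant ![1, 2, 3, 1])
    simp only [hψ] at this
    exact this
  rw [h1, evalCoeffs_generator_eq_zero_iff universalResultant_spec.1 hG]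
  refine exists_congr fun v => ?_
  rw [IsFlexDirection, and_assoc]
  refine and_congr_right fun _ => ?_
  have hlast : eval v (G 3) = ∑ j, u j * v j := by
    change eval v (∑ j, C (u j) * X j) = _
    simp
  constructor
  · intro h
    refine ⟨fun i hi1 hi3 => ?_, hlast ▸ h 3⟩
    interval_cases i
    · exact h 0
    · exact h 1
    · exact h 2
  · rintro ⟨h, hu⟩ i
    fin_cases i
    · exact h 1 (by norm_num) (by norm_num)
    · exact h 2 (by norm_num) (by norm_num)
    · exact h 3 (by norm_num) (by norm_num)
    · exact hlast.trans hu

lemma IsFlexDirection.smul {f : MvPolynomial (Fin 4) ℂ} {p v : Fin 4 → ℂ}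
    (hv : IsFlexDirection f p v) {s : ℂ} (hs : s ≠ 0) : IsFlexDirection f p (s • v) := by
  refine ⟨smul_ne_zero hs hv.1, fun i h1 h3 => ?_⟩
  have h := ((derivForm_isHomogeneous i f).map (eval p)).eval₂_mul_left (RingHom.id ℂ) s v
  change eval (s • v) _ = s ^ i * eval v _ at h
  rw [h, hv.2 i h1 h3, mul_zero]

/-- By homogeneity one representative decides for the whole line of vectors, including `0`; order
zero is the hypothesis on `p`. -/
lemma isFlexDirection_rep_iff {f : MvPolynomial (Fin 4) ℂ} {p : Fin 4 → ℂ} (hp : eval p f = 0)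
    (x : Projectivization ℂ (Fin 4 → ℂ)) :
    (∀ v ∈ x.submodule, Osculates f p v 3) ↔ IsFlexDirection f p x.rep := by
  constructor
  · intro h
    refine ⟨x.rep_nonzero, fun i _ hi => ?_⟩
    rw [eval_derivForm]
    exact h x.rep (by rw [x.submodule_eq]; exact Submodule.mem_span_singleton_self _) i hi
  · intro h v hv i hi
    rw [x.submodule_eq, Submodule.mem_span_singleton] at hv
    obtain ⟨s, rfl⟩ := hv
    rw [← eval_derivForm]
    rcases Nat.eq_zero_or_pos i with rfl | hpos
    · simpa [derivForm] using hp
    have h1 := ((derivForm_isHomogeneous i f).map (eval p)).eval₂_mul_left (RingHom.id ℂ) s x.rep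
    change eval (s • x.rep) _ = s ^ i * eval x.rep _ at h1
    rw [h1, h.2 i hpos hi, mul_zero]

/-- If the directions were finite in number, some `u` would lie off all the hyperplanes `u · v = 0`,
although `U(p; u) = 0` provides a direction on one of them. -/
lemma infinite_of_map_uResultant_eq_zero {f : MvPolynomial (Fin 4) ℂ} {p : Fin 4 → ℂ}
    (hU : map (eval p) (uResultant f) = 0) :
    {x : Projectivization ℂ (Fin 4 → ℂ) | IsFlexDirection f p x.rep}.Infinite := by
  intro hfin
  have hprod : ∏ x ∈ hfin.toFinset, (∑ j, C (x.rep j) * X j : MvPolynomial (Fin 4) ℂ) ≠ 0 := by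
    refine Finset.prod_ne_zero_iff.2 fun x _ h0 => x.rep_nonzero ?_
    funext j
    have := congrArg (eval (Pi.single j 1)) h0
    simpa [Pi.single_apply] using this
  obtain ⟨u, hu⟩ : ∃ u, eval u (∏ x ∈ hfin.toFinset, (∑ j, C (x.rep j) * X j)) ≠ 0 := by
    by_contra! hcon
    exact hprod (MvPolynomial.funext fun u => by rw [hcon u, map_zero])
  obtain ⟨v, hv, huv⟩ := (eval_map_uResultant_eq_zero_iff f p u).1 (by rw [hU, map_zero])
  obtain ⟨a, ha⟩ := Projectivization.exists_smul_eq_mk_rep ℂ v hv.1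
  have hrep : IsFlexDirection f p (Projectivization.mk ℂ v hv.1).rep := by
    rw [← ha]
    exact hv.smul a.ne_zero
  rw [map_prod, Finset.prod_ne_zero_iff] at hu
  refine hu (Projectivization.mk ℂ v hv.1) (hfin.mem_toFinset.2 hrep) ?_
  rw [← ha]
  have : ∑ j, (a : ℂ) * (u j * v j) = 0 := by rw [← Finset.mul_sum, huv, mul_zero]
  rw [← this]
  simp only [map_sum, map_mul, eval_C, eval_X]
  refine Finset.sum_congr rfl fun j _ => ?_
  rw [Pi.smul_apply, Units.smul_def, smul_eq_mul]
  ring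

lemma map_uResultant_eq_zero_of_infinite {f : MvPolynomial (Fin 4) ℂ} {p : Fin 4 → ℂ}
    (hS : {x : Projectivization ℂ (Fin 4 → ℂ) | IsFlexDirection f p x.rep}.Infinite) :
    map (eval p) (uResultant f) = 0 := by
  by_contra hU
  obtain ⟨u, hu⟩ : ∃ u, eval u (map (eval p) (uResultant f)) ≠ 0 := by
    by_contra! hcon
    exact hU (MvPolynomial.funext fun u => by rw [hcon u, map_zero])
  have huv : ∀ v, IsFlexDirection f p v → ∑ j, u j * v j ≠ 0 := fun v hv h =>
    hu ((eval_map_uResultant_eq_zero_iff f p u).2 ⟨v, hv, h⟩)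
  -- As `U(p; u) ≠ 0`, no flex direction is orthogonal to `u`, so each has a unique representative
  -- with `u · v = 1`.
  let V : Set (Fin 4 → ℂ) := {v | IsFlexDirection f p v ∧ ∑ j, u j * v j = 1}
  have hV : V.Infinite := by
    let g : Projectivization ℂ (Fin 4 → ℂ) → Fin 4 → ℂ :=
      fun x => (∑ j, u j * x.rep j)⁻¹ • x.rep
    have hmaps : Set.MapsTo g {x | IsFlexDirection f p x.rep} V := by
      intro x hx
      have h0 := huv _ hx
      refine ⟨IsFlexDirection.smul hx (inv_ne_zero h0), ?_⟩
      simp only [g, Pi.smul_apply, smul_eq_mul, mul_left_comm (u _)]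
      rw [← Finset.mul_sum, inv_mul_cancel₀ h0]
    refine Set.infinite_of_injOn_mapsTo ?_ hmaps hS
    intro x hx y hy hxy
    have hx0 := inv_ne_zero (huv _ hx)
    rw [← x.mk_rep, ← y.mk_rep, Projectivization.mk_eq_mk_iff']
    refine ⟨(∑ j, u j * x.rep j) * (∑ j, u j * y.rep j)⁻¹, ?_⟩
    rw [mul_smul]
    change _ • g y = _
    rw [← hxy]
    simp only [g]
    rw [smul_smul, mul_inv_cancel₀ (huv _ hx), one_smul]
  -- An infinite subset of `ℂ ^ 4` has infinitely many values in some coordinate.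
  obtain ⟨j, hj⟩ : ∃ j, ((fun v : Fin 4 → ℂ => v j) '' V).Infinite := by
    by_contra! hcon
    refine hV ((Set.Finite.pi' (t := fun j => (fun v : Fin 4 → ℂ => v j) '' V)
      fun j => hcon j).subset ?_)
    intro v hv j
    exact ⟨v, hv, rfl⟩
  -- Restriction of `U(p; ·)` to the line `u - t e_j`. For `v` in `V`, `(u - t e_j) · v = 1 - t
  -- v_j`, so `t = 1 / v_j` is a root whenever `v_j ≠ 0`.
  set q : Polynomial ℂ := aeval
    (fun k => Polynomial.C (u k) - Polynomial.X * Polynomial.C ((Pi.single j 1 : Fin 4 → ℂ) k))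
    (map (eval p) (uResultant f)) with hq
  have hqe : ∀ t, q.eval t = eval (fun k => u k - t * (Pi.single j 1 : Fin 4 → ℂ) k)
      (map (eval p) (uResultant f)) := by
    intro t
    rw [hq, ← Polynomial.coe_evalRingHom, aeval_def, hom_eval₂]
    simp only [eval, coe_eval₂Hom]
    congr 1
    · ext; simp
    · funext k; simpa using mul_comm _ _
  have hroots : ((fun v : Fin 4 → ℂ => v j) '' V \ {0}).Infinite :=
    hj.sdiff (Set.finite_singleton 0)
  have hq0 : q = 0 := by
    refine Polynomial.eq_zero_of_infinite_isRoot q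
      ((hroots.image inv_injective.injOn).mono ?_)
    rintro _ ⟨_, ⟨⟨v, hv, rfl⟩, hv0⟩, rfl⟩
    change q.eval _ = 0
    rw [hqe, eval_map_uResultant_eq_zero_iff]
    refine ⟨v, hv.1, ?_⟩
    have hv0 : v j ≠ 0 := hv0
    simp only [sub_mul, Finset.sum_sub_distrib, hv.2]
    simp [Pi.single_apply, hv0]
  apply hu
  have := hqe 0
  rw [hq0] at this
  simpa using this.symm

theorem mainTheorem7 :
    (∀ f : MvPolynomial (Fin 4) ℂ, (uResultant f).IsHomogeneous 6) ∧
    (∃ K : ℕ, ∀ (f : MvPolynomial (Fin 4) ℂ) (m : Fin 4 →₀ ℕ),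
      (coeff m (uResultant f)).totalDegree ≤ K * f.totalDegree) ∧
    (∀ (f : MvPolynomial (Fin 4) ℂ) (p : Fin 4 → ℂ), eval p f = 0 →
      (map (eval p) (uResultant f) = 0 ↔
        {x : Projectivization ℂ (Fin 4 → ℂ) | ∀ v ∈ x.submodule, Osculates f p v 3}.Infinite)) := by
  refine ⟨uResultant_isHomogeneous, ⟨_, totalDegree_coeff_uResultant_le⟩, fun f p hp => ?_⟩
  simp only [isFlexDirection_rep_iff hp]
  exact ⟨infinite_of_map_uResultant_eq_zero, map_uResultant_eq_zero_of_infinite⟩
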